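/- **Set-up.** Let $P$ be a probability distribution on a sample space $\mathcal X$, let $\Theta\subseteq\mathbb R^d$, and let $f(\cdot;x)$, $x\in\mathcal X$, be real-valued losses that are convex on $\Theta$ and such that $f(\theta;\cdot)$ is $P$-integrable for every $\theta\in\Theta$. Put $F_0(\theta)=\mathbb E_P[f(\theta;X)]$ and let $\theta^*\in\Theta$ be its unique minimizer over $\Theta$. Write $\|\cdot\|$ for the Euclidean norm and for the $\ell_2$-operator norm of a matrix. Let $R,\rho,\lambda,G,H,L$ be real numbers with $\rho,\lambda>0$ and $G,H,L\ge0$, let $U=\{\theta:\|\theta-\theta^*\|<\rho\}$, and assume $U\subseteq\Theta$ and: 1. $\Theta$ is compact and convex, $\theta^*\in\operatorname{int}\Theta$, and $R=\max_{\theta\in\Theta}\|\theta-\theta^*\|$. 2. $F_0$ is twice differentiable on $U$ and $\nabla^2F_0(\theta^*)\succeq\lambda I$. 3. For every $x$, $f(\cdot;x)$ is twice differentiable on $U$; for all $\theta\in U$, $\mathbb E\|\nabla f(\theta;X)\|^8\le G^8$ and $\mathbb E\|\nabla^2f(\theta;X)-\nabla^2F_0(\theta)\|^8\le H^8$; and there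 is a function $L(\cdot)$ on $\mathcal X$ with $\|\nabla^2f(\theta';x)-\nabla^2f(\theta;x)\|\le L(x)\|\theta'-\theta\|$ for all $x$ and all $\theta,\theta'\in U$, $\mathbb E[L(X)^8]\le L^8$ and $\mathbb E[(L(X)-\mathbb E L(X))^8]\le L^8$. Let $m,n\ge1$. Let $S_1,\dots,S_m$ be datasets of $n$ samples each, all $mn$ samples being i.i.d. with law $P$. For each $i$ let $\theta_i$ be a (measurable) function of $S_i$ which almost surely satisfies $\theta_i\in\operatorname{argmin}_{\theta\in\Theta}\frac1n\sum_{x\in S_i}f(\theta;x)$, and let $\bar\theta=\frac1m\sum_{i=1}^m\theta_i$. **Theorem.** There are a numerical constant $c>0$, and constants $C_1,C_2\ge 0$ that depend only on $d,R,\rho,\lambda,G,H,L$ (so not on $m$ or $n$), such that for all such problems and all $m,n\ge1$ $$\mathbb E\|\bar\theta-\theta^*\|^2\le\frac{2}{nm}\,\sigma^2+\frac{c}{\lambda^2n^2}\Bigl(H^2\log\max\{d,2\}+\frac{L^2G^2}{\lambda^2}\Bigr)\sigma^2+\frac{C_1}{m\,n^2}+\frac{C_2}{n^3},$$ where $\sigma^2=\mathbb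 E\bigl\|\nabla^2F_0(\theta^*)^{-1}\nabla f(\theta^*;X)\bigr\|^2$. -/

import Mathlib

open MeasureTheory ProbabilityTheory

noncomputable section

namespace AvgM

/-- `ℝᵈ` with the Euclidean norm. -/
abbrev Vec (d : ℕ) : Type := EuclideanSpace ℝ (Fin d)

/-- The Hessian of `F` at `θ`, i.e. the derivative of the gradient field, as a linear operator
on `ℝᵈ`; its norm is the `ℓ₂`-operator norm. -/
def hess {d : ℕ} (F : Vec d → ℝ) (θ : Vec d) : Vec d →L[ℝ] Vec d :=
  fderiv ℝ (gradient F) θ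

/-- `F` is twice differentiable at every point of the open set `U`. -/
def TwiceDiffOn {d : ℕ} (F : Vec d → ℝ) (U : Set (Vec d)) : Prop :=
  ∀ θ ∈ U, DifferentiableAt ℝ F θ ∧ DifferentiableAt ℝ (gradient F) θ

section Risk

variable {d : ℕ} {𝒳 : Type*} [MeasurableSpace 𝒳]

/-- The population risk `F₀(θ) = E_P[f(θ; X)]`. -/
def popRisk (f : Vec d → 𝒳 → ℝ) (P : Measure 𝒳) (θ : Vec d) : ℝ :=
  ∫ x, f θ x ∂P

/-- The empirical risk of a dataset `s` of `n` samples. -/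
def empRisk {n : ℕ} (f : Vec d → 𝒳 → ℝ) (s : Fin n → 𝒳) (θ : Vec d) : ℝ :=
  (1 / (n : ℝ)) * ∑ j, f θ (s j)

/-- `θ` is a minimizer over `Θ` of the empirical risk of the dataset `s`. -/
def IsEmpMin {n : ℕ} (f : Vec d → 𝒳 → ℝ) (Θ : Set (Vec d)) (s : Fin n → 𝒳) (θ : Vec d) : Prop :=
  θ ∈ Θ ∧ ∀ θ' ∈ Θ, empRisk f s θ ≤ empRisk f s θ'

/-- The set-up: convex losses on `Θ` with finite population risk, and `θs` is the unique
minimizer of the population risk over `Θ`. -/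
structure Setup (f : Vec d → 𝒳 → ℝ) (P : Measure 𝒳) (Θ : Set (Vec d)) (θs : Vec d) : Prop where
  convex_loss : ∀ x, ConvexOn ℝ Θ (fun θ => f θ x)
  integrable_loss : ∀ θ ∈ Θ, Integrable (f θ) P
  mem : θs ∈ Θ
  unique_min : ∀ θ ∈ Θ, θ ≠ θs → popRisk f P θs < popRisk f P θ

/-- Parameter space: compact, convex, `θs` in its interior, `R = max_{θ ∈ Θ} ‖θ - θs‖`. -/
structure ParameterSpace (Θ : Set (Vec d)) (θs : Vec d) (R : ℝ) : Prop where
  compact : IsCompact Θ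
  convex : Convex ℝ Θ
  interior : θs ∈ interior Θ
  radius : IsGreatest ((fun θ => ‖θ - θs‖) '' Θ) R

/-- Local strong convexity: the population risk is twice differentiable on `U`, and
`∇²F₀(θs) - lam • I` is positive semidefinite. -/
structure LocalStrongConvexity (f : Vec d → 𝒳 → ℝ) (P : Measure 𝒳) (U : Set (Vec d))
    (θs : Vec d) (lam : ℝ) : Prop where
  twiceDiff : TwiceDiffOn (popRisk f P) U
  curvature :
    (hess (popRisk f P) θs - lam • ContinuousLinearMap.id ℝ (Vec d)).IsPositive

/-- Smoothness of the losses on `U`, with eighth moments bounded by `G ^ 8` (gradient),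
`H ^ 8` (centered Hessian) and `L ^ 8` (Lipschitz modulus of the Hessian). -/
structure Smoothness (f : Vec d → 𝒳 → ℝ) (P : Measure 𝒳) (U : Set (Vec d))
    (G H L : ℝ) : Prop where
  twiceDiff : ∀ x, TwiceDiffOn (fun θ => f θ x) U
  grad_memLp : ∀ θ ∈ U, MemLp (fun x => gradient (fun t => f t x) θ) 8 P
  grad_moment : ∀ θ ∈ U, ∫ x, ‖gradient (fun t => f t x) θ‖ ^ 8 ∂P ≤ G ^ 8
  hess_memLp : ∀ θ ∈ U,
    MemLp (fun x => hess (fun t => f t x) θ - hess (popRisk f P) θ) 8 P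
  hess_moment : ∀ θ ∈ U,
    ∫ x, ‖hess (fun t => f t x) θ - hess (popRisk f P) θ‖ ^ 8 ∂P ≤ H ^ 8
  hess_lipschitz : ∃ lip : 𝒳 → ℝ,
    (∀ x, ∀ θ ∈ U, ∀ θ' ∈ U,
      ‖hess (fun t => f t x) θ' - hess (fun t => f t x) θ‖ ≤ lip x * ‖θ' - θ‖) ∧
    MemLp lip 8 P ∧
    ∫ x, lip x ^ 8 ∂P ≤ L ^ 8 ∧
    ∫ x, (lip x - ∫ y, lip y ∂P) ^ 8 ∂P ≤ L ^ 8

/-- `E ‖∇²F₀(θs)⁻¹ ∇f(θs; X)‖²`. -/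
def asympVar (f : Vec d → 𝒳 → ℝ) (P : Measure 𝒳) (θs : Vec d) : ℝ :=
  ∫ x, ‖(hess (popRisk f P) θs).inverse (gradient (fun t => f t x) θs)‖ ^ 2 ∂P

end Risk

end AvgM

end

noncomputable section

namespace AvgM

/-! ### Rademacher sums -/

/-! Write Δ for the error of one machine, Q for the population Hessian at θ*, and v for Q⁻¹ applied
to the empirical mean of the gradients at θ*. By independence of the machines, the mean square of
the averaged error is at most E‖Δ‖²/m + ‖EΔ‖² (`integral_norm_average_sq_le`), so a single machine
needs a mean square of order 1/n and a squared bias of order 1/n².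

Let t be the sum of the empirical fluctuations at θ*: a for the gradient, p for the Hessian, l for
its Lipschitz modulus. If t is below a fixed threshold, convexity localizes the empirical minimizer
near θ* (`minimizer_near`), and the first order condition gives Δ = -v + remainder, the remainder
being at most (p‖Δ‖ + (L + l)‖Δ‖²)/λ. If t is above the threshold, then ‖Δ‖ ≤ R is bounded by a
constant times any power of t. Hence the same bounds hold for every dataset (`expansion_bounds`),
and no exceptional event has to be estimated separately.

Since E t⁸ = O(n⁻⁴), the mean square is at most 2σ²/n + O(n⁻²). As v is centered, the bias is the
mean of the remainder. Cauchy–Schwarz bounds its main part by the product of E(p + 2La/λ)² and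
E‖Δ‖², which is where σ² enters the 1/n² term (`mean_square_and_bias_le`).

The factor log d comes from E p². Symmetrization reduces it to a Rademacher sum of operators. A
trace moment of that sum is a noncommutative polynomial in the signs; all sign monomials have
nonnegative average, so it is bounded by the same polynomial in the norms of the summands, at the
cost of a factor d. A moment of order log d absorbs this factor. -/

/-- The sign `±1` of a Boolean. -/
def sgn (b : Bool) : ℝ := if b then 1 else -1

/-- The average over all sign patterns. -/
def signAvg {ι : Type*} [Fintype ι] [DecidableEq ι] {W : Type*} [AddCommGroup W] [Module ℝ W]
    (φ : (ι → Bool) → W) : W :=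
  ((2 : ℝ) ^ Fintype.card ι)⁻¹ • ∑ ε : ι → Bool, φ ε

section Scalar

variable {ι : Type*} [Fintype ι] [DecidableEq ι]

lemma signAvg_mono {φ ψ : (ι → Bool) → ℝ} (h : ∀ ε, φ ε ≤ ψ ε) : signAvg φ ≤ signAvg ψ := by
  unfold signAvg
  simp only [smul_eq_mul]
  gcongr with ε
  exact h ε

lemma signAvg_const_mul (c : ℝ) (φ : (ι → Bool) → ℝ) :
    signAvg (fun ε => c * φ ε) = c * signAvg φ := by
  simp only [signAvg, ← Finset.mul_sum, smul_eq_mul]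
  ring

lemma signAvg_const (c : ℝ) : signAvg (fun _ : ι → Bool => c) = c := by
  simp [signAvg]

/-- Independence of the signs: expanding a product of two-term sums gives one term per sign pattern.
-/
lemma signAvg_prod (u : ι → Bool → ℝ) :
    signAvg (fun ε => ∏ i, u i (ε i)) = ∏ i, (u i true + u i false) / 2 := by
  have h := Finset.prod_univ_sum (fun _ : ι => (Finset.univ : Finset Bool)) u
  rw [Fintype.piFinset_univ] at h
  simp only [signAvg, smul_eq_mul, ← h, Fintype.sum_bool, Finset.prod_div_distrib,
    Finset.prod_const, Finset.card_univ]
  rw [div_eq_inv_mul]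

/-- Subgaussian bound: by independence each sign contributes cosh (b i) ≤ exp (b i ^ 2 / 2). -/
lemma signAvg_exp_le (b : ι → ℝ) :
    signAvg (fun ε => Real.exp (∑ i, sgn (ε i) * b i)) ≤ Real.exp ((∑ i, b i ^ 2) / 2) := by
  simp only [Real.exp_sum]
  rw [signAvg_prod (fun i s => Real.exp (sgn s * b i)), Finset.sum_div, Real.exp_sum]
  refine Finset.prod_le_prod (fun i _ => by positivity) fun i _ => ?_
  have := Real.cosh_le_exp_half_sq (b i)
  rw [Real.cosh_eq] at this
  simpa [sgn] using this

/-- A single term of the exponential series at |x|; this converts exponential moments into even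
moments. -/
lemma pow_two_mul_le_factorial_mul_exp (x : ℝ) (k : ℕ) :
    x ^ (2 * k) ≤ (2 * k).factorial * (Real.exp x + Real.exp (-x)) := by
  have h := Real.pow_div_factorial_le_exp |x| (abs_nonneg x) (2 * k)
  rw [div_le_iff₀ (by positivity), Even.pow_abs (even_two_mul k)] at h
  have : Real.exp |x| ≤ Real.exp x + Real.exp (-x) := by
    rcases abs_cases x with h | h <;> rw [h.1] <;> linarith [Real.exp_pos x, Real.exp_pos (-x)]
  nlinarith [show (0 : ℝ) < (2 * k).factorial by positivity]

lemma signAvg_pow_le (b : ι → ℝ) {k : ℕ} (hk : 0 < k) :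
    signAvg (fun ε => (∑ i, sgn (ε i) * b i) ^ (2 * k))
      ≤ 2 * (2 * Real.exp 1 * k * ∑ i, b i ^ 2) ^ k := by
  set v := ∑ i, b i ^ 2 with hv
  have hv0 : 0 ≤ v := Finset.sum_nonneg fun i _ => sq_nonneg _
  rcases hv0.eq_or_lt with h0 | hvpos
  · have hb : ∀ i, b i = 0 := by
      intro i
      have := (Finset.sum_eq_zero_iff_of_nonneg (fun i _ => sq_nonneg (b i))).1 h0.symm i
        (Finset.mem_univ i)
      simpa using this
    simp only [hb, mul_zero, Finset.sum_const_zero]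
    rw [signAvg_const, ← h0]
    simp [hk.ne']
  have hk' : (0 : ℝ) < k := by exact_mod_cast hk
  -- The scale s makes the exponential moment exp (s² v / 2) = exp k. With (2k)! ≤ (2k)^(2k),
  -- division by s^(2k) leaves the stated constant.
  set s := Real.sqrt (2 * k / v) with hs
  have hs2 : s ^ 2 = 2 * k / v := Real.sq_sqrt (by positivity)
  have hspos : 0 < s := Real.sqrt_pos.2 (by positivity)
  have hexp : ∀ t : ℝ, t ^ 2 = s ^ 2 →
      signAvg (fun ε : ι → Bool => Real.exp (t * ∑ i, sgn (ε i) * b i)) ≤ Real.exp k := by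
    intro t ht
    have h := signAvg_exp_le (fun i => t * b i)
    simp only [mul_pow, ← Finset.mul_sum] at h
    rw [ht, hs2, ← hv] at h
    have e1 : 2 * (k : ℝ) / v * v / 2 = k := by field_simp
    rw [e1] at h
    convert h using 5
    rw [Finset.mul_sum]
    refine Finset.sum_congr rfl fun i _ => by ring
  have h1 : signAvg (fun ε : ι → Bool => (s * ∑ i, sgn (ε i) * b i) ^ (2 * k))
      ≤ (2 * k).factorial * (2 * Real.exp k) := by
    refine (signAvg_mono fun ε => pow_two_mul_le_factorial_mul_exp _ k).trans ?_
    rw [signAvg_const_mul]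
    gcongr
    have e : signAvg (fun ε : ι → Bool => Real.exp (s * ∑ i, sgn (ε i) * b i)
        + Real.exp (-(s * ∑ i, sgn (ε i) * b i)))
        = signAvg (fun ε : ι → Bool => Real.exp (s * ∑ i, sgn (ε i) * b i))
          + signAvg (fun ε : ι → Bool => Real.exp ((-s) * ∑ i, sgn (ε i) * b i)) := by
      simp only [signAvg, Finset.sum_add_distrib, smul_add, neg_mul]
    rw [e]
    linarith [hexp s rfl, hexp (-s) (by ring)]
  simp only [mul_pow _ _ (2 * k)] at h1
  rw [signAvg_const_mul] at h1
  have hfac : ((2 * k).factorial : ℝ) ≤ (2 * k : ℝ) ^ (2 * k) := by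
    exact_mod_cast Nat.factorial_le_pow (2 * k)
  have hs2k : s ^ (2 * k) = (2 * k / v) ^ k := by rw [pow_mul, hs2]
  have e2 : (2 * k / v) ^ k * (2 * (2 * Real.exp 1 * k * v) ^ k)
      = (2 * k : ℝ) ^ (2 * k) * (2 * Real.exp k) := by
    rw [show Real.exp (k : ℝ) = Real.exp 1 ^ k by rw [← Real.exp_nat_mul]; simp, pow_mul,
      mul_left_comm, ← mul_pow]
    rw [show 2 * (k : ℝ) / v * (2 * Real.exp 1 * k * v) = (2 * k) ^ 2 * Real.exp 1 by
      field_simp, mul_pow]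
    ring
  have h2 : s ^ (2 * k) * signAvg (fun ε : ι → Bool => (∑ i, sgn (ε i) * b i) ^ (2 * k))
      ≤ s ^ (2 * k) * (2 * (2 * Real.exp 1 * k * v) ^ k) := by
    rw [hs2k, e2, ← hs2k]
    exact h1.trans (by gcongr)
  exact le_of_mul_le_mul_left h2 (by positivity)

end Scalar

/-! ### Operator-valued Rademacher sums: the moment method -/

section Dominated

set_option linter.unusedSectionVars false

variable {ι : Type} [Fintype ι] [DecidableEq ι]

/-- The Rademacher sum of the vectors `B i` with signs `ε i`. -/
def radSum {W : Type*} [AddCommGroup W] [Module ℝ W] (B : ι → W) (ε : ι → Bool) : W :=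
  ∑ i, sgn (ε i) • B i

/-- `T` is a polynomial in the signs whose coefficients are bounded in norm by the corresponding
coefficients of the scalar polynomial `t`. -/
def Dominated {W : Type*} [NormedAddCommGroup W] [NormedSpace ℝ W] (T : (ι → Bool) → W)
    (t : (ι → Bool) → ℝ) : Prop :=
  ∃ (κ : Type) (_ : Fintype κ) (a : κ → ι → ℕ) (C : κ → W) (c : κ → ℝ),
    (∀ k, ‖C k‖ ≤ c k) ∧ (∀ ε, T ε = ∑ k, (∏ i, sgn (ε i) ^ a k i) • C k) ∧
      ∀ ε, t ε = ∑ k, (∏ i, sgn (ε i) ^ a k i) * c k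

/-- The average factors over the signs: an even exponent gives 1, an odd one 0. This positivity is
what lets operator coefficients be replaced by their norms. -/
lemma signAvg_monomial_nonneg (a : ι → ℕ) :
    0 ≤ signAvg (fun ε : ι → Bool => ∏ i, sgn (ε i) ^ a i) := by
  rw [signAvg_prod (fun i s => sgn s ^ a i)]
  refine Finset.prod_nonneg fun i _ => ?_
  rcases Nat.even_or_odd (a i) with h | h <;> simp [sgn, h.neg_one_pow]

lemma signAvg_sum {W κ : Type*} [AddCommGroup W] [Module ℝ W] [Fintype κ]
    (φ : κ → (ι → Bool) → W) :
    signAvg (fun ε => ∑ k, φ k ε) = ∑ k, signAvg (φ k) := by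
  simp only [signAvg]
  rw [Finset.sum_comm, Finset.smul_sum]

lemma signAvg_smul_const {W : Type*} [AddCommGroup W] [Module ℝ W] (φ : (ι → Bool) → ℝ) (C : W) :
    signAvg (fun ε => φ ε • C) = signAvg φ • C := by
  simp only [signAvg, ← Finset.sum_smul, smul_assoc]

/-- Triangle inequality monomial by monomial, after averaging. For an individual sign pattern the
norm of `T ε` need not be at most `t ε`. -/
lemma Dominated.norm_signAvg_le {W : Type*} [NormedAddCommGroup W] [NormedSpace ℝ W]
    {T : (ι → Bool) → W} {t : (ι → Bool) → ℝ} (h : Dominated T t) :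
    ‖signAvg T‖ ≤ signAvg t := by
  obtain ⟨κ, _, a, C, c, hC, hT, ht⟩ := h
  rw [funext hT, funext ht, signAvg_sum, signAvg_sum]
  refine (norm_sum_le _ _).trans (Finset.sum_le_sum fun k _ => ?_)
  have hn := signAvg_monomial_nonneg (a k)
  have e := signAvg_smul_const (fun ε : ι → Bool => ∏ i, sgn (ε i) ^ a k i) (c k)
  simp only [smul_eq_mul] at e
  rw [signAvg_smul_const, norm_smul, Real.norm_of_nonneg hn, e]
  exact mul_le_mul_of_nonneg_left (hC k) hn

/-- The signs are scalars, so noncommutativity affects only the coefficients, and these are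
controlled by submultiplicativity of the norm. -/
lemma Dominated.mul {A : Type*} [NormedRing A] [NormedAlgebra ℝ A] {T U : (ι → Bool) → A}
    {t u : (ι → Bool) → ℝ} (hT : Dominated T t) (hU : Dominated U u) :
    Dominated (fun ε => T ε * U ε) (fun ε => t ε * u ε) := by
  obtain ⟨κ, _, a, C, c, hC, hT, ht⟩ := hT
  obtain ⟨κ', _, a', C', c', hC', hU, hu⟩ := hU
  refine ⟨κ × κ', inferInstance, fun p i => a p.1 i + a' p.2 i, fun p => C p.1 * C' p.2,
    fun p => c p.1 * c' p.2, fun p => ?_, fun ε => ?_, fun ε => ?_⟩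
  · exact (norm_mul_le _ _).trans
      (mul_le_mul (hC _) (hC' _) (norm_nonneg _) ((norm_nonneg _).trans (hC _)))
  · simp only [hT, hU, Finset.sum_mul_sum, Fintype.sum_prod_type, pow_add, Finset.prod_mul_distrib,
      smul_mul_smul_comm]
  · simp only [ht, hu, Finset.sum_mul_sum, Fintype.sum_prod_type, pow_add, Finset.prod_mul_distrib,
      mul_mul_mul_comm]

lemma Dominated.pow_succ {A : Type*} [NormedRing A] [NormedAlgebra ℝ A] {T : (ι → Bool) → A}
    {t : (ι → Bool) → ℝ} (hT : Dominated T t) (k : ℕ) :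
    Dominated (fun ε => T ε ^ (k + 1)) (fun ε => t ε ^ (k + 1)) := by
  induction k with
  | zero => simpa using hT
  | succ k ih => simpa only [_root_.pow_succ _ (k + 1)] using ih.mul hT

variable {E F : Type*} [NormedAddCommGroup E] [InnerProductSpace ℝ E] [FiniteDimensional ℝ E]
  [CompleteSpace E] [NormedAddCommGroup F] [InnerProductSpace ℝ F] [CompleteSpace F]

/-- `S†S`. -/
def gram (S : E →L[ℝ] F) : E →L[ℝ] E :=
  ContinuousLinearMap.adjoint S ∘L S

lemma dominated_gram_radSum (B : ι → E →L[ℝ] F) :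
    Dominated (fun ε => gram (radSum B ε)) (fun ε => (∑ i, sgn (ε i) * ‖B i‖) ^ 2) := by
  -- The exponent vector of the monomial ε_i ε_j; on the diagonal it is a square.
  have hprod : ∀ (ε : ι → Bool) (p : ι × ι),
      ∏ i, sgn (ε i) ^ ((Pi.single p.1 1 + Pi.single p.2 1 : ι → ℕ) i)
        = sgn (ε p.1) * sgn (ε p.2) := by
    intro ε p
    simp only [Pi.add_apply, pow_add, Finset.prod_mul_distrib, Pi.single_apply, pow_ite, pow_one,
      pow_zero, Finset.prod_ite_eq', Finset.mem_univ, if_true]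
  refine ⟨ι × ι, inferInstance, fun p => Pi.single p.1 1 + Pi.single p.2 1,
    fun p => ContinuousLinearMap.adjoint (B p.1) ∘L B p.2, fun p => ‖B p.1‖ * ‖B p.2‖,
    fun p => ?_, fun ε => ?_, fun ε => ?_⟩
  · refine (ContinuousLinearMap.opNorm_comp_le _ _).trans ?_
    rw [LinearIsometryEquiv.norm_map]
  · simp only [hprod, gram, radSum, map_sum, map_smulₛₗ, Fintype.sum_prod_type]
    ext x
    simp only [ContinuousLinearMap.comp_apply, sum_apply, smul_apply, map_sum, map_smul,
      Finset.smul_sum, smul_smul, conj_trivial]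
    rw [Finset.sum_comm]
    exact Finset.sum_congr rfl fun i _ => Finset.sum_congr rfl fun j _ => by rw [mul_comm]
  · simp only [hprod, sq, Finset.sum_mul_sum, Fintype.sum_prod_type]
    exact Finset.sum_congr rfl fun i _ => Finset.sum_congr rfl fun j _ => by ring

/-- The Hilbert–Schmidt norm dominates the operator norm. -/
lemma norm_sq_le_sum_basis {κ : Type*} [Fintype κ] (b : OrthonormalBasis κ ℝ E)
    (T : E →L[ℝ] F) : ‖T‖ ^ 2 ≤ ∑ i, ‖T (b i)‖ ^ 2 := by
  have h : ‖T‖ ≤ Real.sqrt (∑ i, ‖T (b i)‖ ^ 2) := by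
    refine T.opNorm_le_bound (Real.sqrt_nonneg _) fun x => ?_
    conv_lhs => rw [← b.sum_repr x]
    rw [map_sum]
    refine (norm_sum_le _ _).trans ?_
    simp only [map_smul, norm_smul]
    refine (Real.sum_mul_le_sqrt_mul_sqrt _ _ _).trans ?_
    rw [mul_comm]
    gcongr
    rw [← LinearIsometryEquiv.norm_map b.repr x, EuclideanSpace.norm_eq]
  calc ‖T‖ ^ 2 ≤ Real.sqrt (∑ i, ‖T (b i)‖ ^ 2) ^ 2 := by gcongr
    _ = _ := Real.sq_sqrt (Finset.sum_nonneg fun i _ => sq_nonneg _)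

/-- The Hilbert–Schmidt bound for the power 2^q of S†S. Iterating ‖A²‖ = ‖A‖² for selfadjoint A
computes the norm of this power, hence the powers of two; the right side is the trace of its square.
-/
lemma norm_pow_le_trace_gram (S : E →L[ℝ] F) (q : ℕ) :
    ‖S‖ ^ (2 * 2 ^ (q + 1)) ≤ ∑ i, inner ℝ (stdOrthonormalBasis ℝ E i)
      ((gram S ^ 2 ^ (q + 1)) (stdOrthonormalBasis ℝ E i)) := by
  have hsa : IsSelfAdjoint (gram S) := by
    rw [ContinuousLinearMap.isSelfAdjoint_iff']
    simp [gram, ContinuousLinearMap.adjoint_comp]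
  have hnorm : ‖gram S‖ = ‖S‖ ^ 2 := by
    rw [sq]; exact ContinuousLinearMap.norm_adjoint_comp_self S
  have hB : ‖gram S ^ 2 ^ q‖ = ‖S‖ ^ (2 ^ (q + 1)) := by
    have h := congrArg NNReal.toReal (IsSelfAdjoint.nnnorm_pow_two_pow (E := E →L[ℝ] E) hsa q)
    simp only [coe_nnnorm, NNReal.coe_pow] at h
    rw [h, hnorm, ← pow_mul, pow_succ']
  have hsa' : IsSelfAdjoint (gram S ^ 2 ^ q) := hsa.pow _
  have h := norm_sq_le_sum_basis (stdOrthonormalBasis ℝ E) (gram S ^ 2 ^ q)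
  rw [hB, ← pow_mul, mul_comm] at h
  refine h.trans_eq (Finset.sum_congr rfl fun i _ => ?_)
  rw [pow_succ 2 q, pow_mul (gram S), sq (gram S ^ 2 ^ q), ← real_inner_self_eq_norm_sq,
    mul_apply_eq_comp, ← ContinuousLinearMap.adjoint_inner_left,
    ContinuousLinearMap.isSelfAdjoint_iff'.1 hsa', real_inner_comm]

/-- Moments of a Rademacher sum of operators in the operator norm. -/
lemma signAvg_norm_radSum_pow_le (B : ι → E →L[ℝ] F) (q : ℕ) :
    signAvg (fun ε => ‖radSum B ε‖ ^ (2 * 2 ^ (q + 1)))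
      ≤ 2 * Module.finrank ℝ E * (2 * Real.exp 1 * (2 ^ (q + 1) : ℕ) * ∑ i, ‖B i‖ ^ 2)
        ^ (2 ^ (q + 1)) := by
  set b := stdOrthonormalBasis ℝ E
  set k := 2 ^ (q + 1) with hk
  have hkpos : 0 < k := by positivity
  obtain ⟨k', hk'⟩ : ∃ k', k = k' + 1 := ⟨k - 1, by omega⟩
  have hdom : ‖signAvg (fun ε => gram (radSum B ε) ^ k)‖
      ≤ 2 * (2 * Real.exp 1 * k * ∑ i, ‖B i‖ ^ 2) ^ k := by
    have h := ((dominated_gram_radSum B).pow_succ k').norm_signAvg_le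
    rw [← hk'] at h
    simp only [← pow_mul] at h
    exact h.trans (signAvg_pow_le _ hkpos)
  calc signAvg (fun ε => ‖radSum B ε‖ ^ (2 * k))
      ≤ signAvg (fun ε => ∑ i, inner ℝ (b i) ((gram (radSum B ε) ^ k) (b i))) :=
        signAvg_mono fun ε => norm_pow_le_trace_gram _ q
    -- The trace is linear, so the average moves inside before norms are taken; domination applies
    -- only to the averaged operator.
    _ = ∑ i, inner ℝ (b i) (signAvg (fun ε => gram (radSum B ε) ^ k) (b i)) := by
        rw [signAvg_sum]
        refine Finset.sum_congr rfl fun i _ => ?_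
        simp only [signAvg, smul_apply, sum_apply,
          inner_smul_right, inner_sum, smul_eq_mul]
    _ ≤ ∑ _i : Fin (Module.finrank ℝ E), ‖signAvg (fun ε => gram (radSum B ε) ^ k)‖ := by
        refine Finset.sum_le_sum fun i _ => ?_
        refine (real_inner_le_norm _ _).trans ?_
        have h := (signAvg (fun ε => gram (radSum B ε) ^ k)).le_opNorm (b i)
        rw [b.norm_eq_one, mul_one] at h
        rw [b.norm_eq_one, one_mul]
        exact h
    _ ≤ _ := by
        rw [Finset.sum_const, Finset.card_univ, Fintype.card_fin, nsmul_eq_mul, mul_comm 2,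
          mul_assoc]
        gcongr

lemma signAvg_pow_le_signAvg_pow {φ : (ι → Bool) → ℝ} (h0 : ∀ ε, 0 ≤ φ ε) (k : ℕ) :
    signAvg φ ^ k ≤ signAvg (fun ε => φ ε ^ k) := by
  have h := Real.pow_arith_mean_le_arith_mean_pow Finset.univ
    (fun _ : ι → Bool => ((2 : ℝ) ^ Fintype.card ι)⁻¹) φ (fun _ _ => by positivity)
    (by simp) (fun ε _ => h0 ε) k
  simpa only [signAvg, ← Finset.mul_sum, smul_eq_mul] using h

/-- Choice of the moment order k, a power of two: the lower bound gives 2d ≤ exp k, so the dimension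
costs only a factor e after taking a k-th root; the upper bound produces the logarithm in the final
estimate. -/
lemma exists_two_pow_between (d : ℕ) :
    ∃ q : ℕ, Real.log (2 * d) ≤ (2 ^ (q + 1) : ℕ) ∧
      ((2 ^ (q + 1) : ℕ) : ℝ) ≤ 8 * Real.log (max d 2 : ℕ) := by
  set D := max d 2 with hD
  have hD2 : 2 ≤ D := le_max_right _ _
  have hlog : Real.log 2 ≤ Real.log D := Real.log_le_log (by norm_num) (by exact_mod_cast hD2)
  have hl2 := Real.log_two_gt_d9
  -- Here log D ≥ log 2 > 1/2, so N ≥ 2. Rounding up to a power of two at most doubles N, and 2 N ≤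
  -- 4 log D + 2 ≤ 8 log D.
  set N := ⌈2 * Real.log D⌉₊ with hN
  have hN1 : 2 * Real.log D ≤ N := Nat.le_ceil _
  have hN2 : (N : ℝ) < 2 * Real.log D + 1 := Nat.ceil_lt_add_one (by linarith)
  have h1N : 1 < N := by
    have : (1 : ℝ) < N := by linarith
    exact_mod_cast this
  have hc : 0 < Nat.clog 2 N := Nat.clog_pos (by norm_num) h1N
  obtain ⟨q, hq⟩ : ∃ q, Nat.clog 2 N = q + 1 := ⟨Nat.clog 2 N - 1, by omega⟩
  refine ⟨q, ?_, ?_⟩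
  · have h1 : N ≤ 2 ^ (q + 1) := hq ▸ Nat.le_pow_clog (by norm_num) N
    have h2 : Real.log (2 * d) ≤ 2 * Real.log D := by
      rcases Nat.eq_zero_or_pos d with h | h
      · subst h; simp; linarith
      · have hd : (0 : ℝ) < d := by exact_mod_cast h
        rw [Real.log_mul (by norm_num) hd.ne']
        have : Real.log d ≤ Real.log D := Real.log_le_log hd (by exact_mod_cast le_max_left _ _)
        linarith
    have h3 : (N : ℝ) ≤ (2 ^ (q + 1) : ℕ) := by exact_mod_cast h1
    linarith
  · have h1 : 2 ^ q < N := by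
      have := Nat.pow_pred_clog_lt_self (b := 2) (by norm_num) h1N
      rw [hq] at this
      simpa using this
    have h2 : ((2 ^ (q + 1) : ℕ) : ℝ) ≤ 2 * N := by
      rw [pow_succ']
      exact_mod_cast Nat.mul_le_mul_left 2 h1.le
    linarith

/-- The operator norm has type 2 with constant of order `√(log d)`. -/
lemma signAvg_norm_radSum_sq_le (B : ι → E →L[ℝ] F) :
    signAvg (fun ε => ‖radSum B ε‖ ^ 2)
      ≤ 16 * Real.exp 2 * Real.log (max (Module.finrank ℝ E) 2 : ℕ) * ∑ i, ‖B i‖ ^ 2 := by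
  obtain ⟨q, hq1, hq2⟩ := exists_two_pow_between (Module.finrank ℝ E)
  have hv : 0 ≤ ∑ i, ‖B i‖ ^ 2 := Finset.sum_nonneg fun i _ => sq_nonneg _
  have h := signAvg_norm_radSum_pow_le B q
  set k := 2 ^ (q + 1) with hk
  set d := Module.finrank ℝ E
  have hkpos : k ≠ 0 := by positivity
  -- Jensen passes from the second moment to the moment of order 2k, where 2d ≤ exp k is absorbed
  -- into the k-th power.
  have h1 : signAvg (fun ε => ‖radSum B ε‖ ^ 2) ^ k
      ≤ (Real.exp 1 * (2 * Real.exp 1 * k * ∑ i, ‖B i‖ ^ 2)) ^ k := by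
    refine (signAvg_pow_le_signAvg_pow (fun ε => sq_nonneg _) k).trans ?_
    simp only [← pow_mul]
    refine h.trans ?_
    rw [mul_pow (Real.exp 1)]
    gcongr
    rw [← Real.exp_nat_mul, mul_one]
    rcases Nat.eq_zero_or_pos d with h0 | h0
    · simp [h0]; positivity
    · have : (0 : ℝ) < 2 * d := by positivity
      rw [← Real.exp_log this]
      exact Real.exp_le_exp.2 hq1
  have h2 := le_of_pow_le_pow_left₀ hkpos (by positivity) h1
  refine h2.trans ?_
  have e : Real.exp 2 = Real.exp 1 * Real.exp 1 := by rw [← Real.exp_add]; norm_num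
  rw [e]
  have : 0 ≤ Real.exp 1 * Real.exp 1 * ∑ i, ‖B i‖ ^ 2 := by positivity
  nlinarith

end Dominated

/-! ### Symmetrization -/

section Symmetrization

set_option linter.unusedSectionVars false

lemma integral_comp_measurePreserving {α β W : Type*} [MeasurableSpace α] [MeasurableSpace β]
    [NormedAddCommGroup W] [NormedSpace ℝ W] {μ : Measure α} {ν : Measure β} {φ : α → β}
    (hφ : MeasurePreserving φ μ ν) {f : β → W} (hf : AEStronglyMeasurable f ν) :
    ∫ x, f (φ x) ∂μ = ∫ y, f y ∂ν := by
  rw [← hφ.map_eq] at hf ⊢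
  exact (integral_map hφ.measurable.aemeasurable hf).symm

/-- Jensen applied to w = E(w - g). It introduces the independent copy in the symmetrization. -/
lemma norm_pow_le_integral_norm_sub_pow {α W : Type*} [MeasurableSpace α] [NormedAddCommGroup W]
    [NormedSpace ℝ W] [CompleteSpace W] {μ : Measure α} [IsProbabilityMeasure μ] {g : α → W}
    {p : ℕ} (hp : 1 ≤ p) (hg : MemLp g p μ) (h0 : ∫ x, g x ∂μ = 0) (w : W) :
    ‖w‖ ^ p ≤ ∫ x, ‖w - g x‖ ^ p ∂μ := by
  have hg' : MemLp (fun x => w - g x) p μ := (memLp_const w).sub hg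
  have hp1 : (1 : ENNReal) ≤ p := by exact_mod_cast hp
  have hint : Integrable (fun x => w - g x) μ := hg'.integrable hp1
  have e : ∫ x, (w - g x) ∂μ = w := by
    rw [integral_sub (integrable_const w) (hg.integrable hp1), h0]
    simp
  calc ‖w‖ ^ p = ‖∫ x, (w - g x) ∂μ‖ ^ p := by rw [e]
    _ ≤ (∫ x, ‖w - g x‖ ∂μ) ^ p := by
        gcongr
        exact norm_integral_le_integral_norm _
    _ ≤ _ := ConvexOn.map_integral_le (convexOn_pow p) (continuous_pow p).continuousOn isClosed_Ici
        (Filter.Eventually.of_forall fun x => norm_nonneg _) hint.norm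
        (hg'.integrable_norm_pow (by omega))

variable {𝒳 : Type*} [MeasurableSpace 𝒳] {P : Measure 𝒳} [IsProbabilityMeasure P]
  {W : Type*} [NormedAddCommGroup W] [NormedSpace ℝ W]

lemma memLp_sum_pi {Y : 𝒳 → W} {p : ENNReal} (hY : MemLp Y p P) (n : ℕ) :
    MemLp (fun x : Fin n → 𝒳 => ∑ j, Y (x j)) p (Measure.pi fun _ => P) :=
  memLp_finsetSum _ fun j _ => hY.comp_measurePreserving (measurePreserving_eval (fun _ => P) j)

lemma integrable_eval_pi {Y : 𝒳 → W} (hY : Integrable Y P) {n : ℕ} (j : Fin n) :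
    Integrable (fun x : Fin n → 𝒳 => Y (x j)) (Measure.pi fun _ => P) :=
  (measurePreserving_eval (fun _ => P) j).integrable_comp_of_integrable hY

lemma integral_eval_pi {Y : 𝒳 → W} (hY : AEStronglyMeasurable Y P) {n : ℕ} (j : Fin n) :
    ∫ x : Fin n → 𝒳, Y (x j) ∂(Measure.pi fun _ => P) = ∫ x, Y x ∂P :=
  integral_comp_measurePreserving (measurePreserving_eval (fun _ => P) j) hY

lemma integral_sum_pi {Y : 𝒳 → W} (hY : Integrable Y P) (n : ℕ) :
    ∫ x : Fin n → 𝒳, ∑ j, Y (x j) ∂(Measure.pi fun _ => P) = (n : ℝ) • ∫ x, Y x ∂P := by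
  rw [integral_finsetSum _ fun j _ => integrable_eval_pi hY j]
  simp [integral_eval_pi hY.1, Nat.cast_smul_eq_nsmul]

/-- Exchanging a sample with its independent copy preserves the law and flips the sign of their
difference; this is how random signs enter. -/
lemma measurePreserving_signSwap {n : ℕ} (ε : Fin n → Bool) :
    MeasurePreserving (fun (z : Fin n → 𝒳 × 𝒳) j => if ε j then z j else (z j).swap)
      (Measure.pi fun _ => P.prod P) (Measure.pi fun _ => P.prod P) := by
  refine measurePreserving_pi (fun _ => P.prod P) (fun _ => P.prod P)
    (f := fun j z => if ε j then z else z.swap) fun j => ?_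
  cases ε j
  · simpa using Measure.measurePreserving_swap (μ := P) (ν := P)
  · simp only [if_true]
    exact MeasurePreserving.id (P.prod P)

variable [CompleteSpace W]

/-- A moment bound for Rademacher sums in `W` yields one for sums of centered i.i.d. variables. -/
lemma integral_norm_sum_pow_le {k : ℕ} (hk : 0 < k) {K : ℝ} (hK0 : 0 ≤ K) {n : ℕ}
    (hK : ∀ B : Fin n → W, signAvg (fun ε => ‖radSum B ε‖ ^ (2 * k)) ≤ K * (∑ i, ‖B i‖ ^ 2) ^ k)
    {Y : 𝒳 → W} (hY : MemLp Y (2 * k : ℕ) P) (h0 : ∫ x, Y x ∂P = 0) :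
    ∫ x : Fin n → 𝒳, ‖∑ j, Y (x j)‖ ^ (2 * k) ∂(Measure.pi fun _ => P)
      ≤ K * (n : ℝ) ^ k * 4 ^ k * ∫ x, ‖Y x‖ ^ (2 * k) ∂P := by
  set p := 2 * k with hp
  have hp0 : p ≠ 0 := by omega
  have hp1 : (1 : ENNReal) ≤ (p : ENNReal) := by exact_mod_cast (by omega : 1 ≤ p)
  set μ := Measure.pi fun _ : Fin n => P
  set ν := Measure.pi fun _ : Fin n => P.prod P
  set g : (Fin n → 𝒳) → W := fun x => ∑ j, Y (x j) with hg
  set D : 𝒳 × 𝒳 → W := fun z => Y z.1 - Y z.2 with hD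
  have hgL : MemLp g p μ := memLp_sum_pi hY n
  have hg0 : ∫ x, g x ∂μ = 0 := by
    rw [hg, integral_sum_pi (hY.integrable hp1), h0, smul_zero]
  have hdiff : MemLp (fun z : (Fin n → 𝒳) × (Fin n → 𝒳) => g z.1 - g z.2) p (μ.prod μ) :=
    (hgL.comp_fst μ).sub (hgL.comp_snd μ)
  have hDL : MemLp D p (P.prod P) := (hY.comp_fst P).sub (hY.comp_snd P)
  have hDint : Integrable (fun z => ‖D z‖ ^ p) (P.prod P) := hDL.integrable_norm_pow hp0
  have h1 : ∫ x, ‖g x‖ ^ p ∂μ ≤ ∫ z, ‖g z.1 - g z.2‖ ^ p ∂(μ.prod μ) := by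
    rw [integral_prod _ (hdiff.integrable_norm_pow hp0)]
    exact integral_mono (hgL.integrable_norm_pow hp0)
      (hdiff.integrable_norm_pow hp0).integral_prod_left
      fun x => norm_pow_le_integral_norm_sub_pow (by omega) hgL hg0 (g x)
  have h2 : ∫ z, ‖g z.1 - g z.2‖ ^ p ∂(μ.prod μ) = ∫ z, ‖∑ j, D (z j)‖ ^ p ∂ν := by
    rw [← integral_comp_measurePreserving
      (measurePreserving_arrowProdEquivProdArrow 𝒳 𝒳 (Fin n) (fun _ => P) (fun _ => P))
      (hdiff.integrable_norm_pow hp0).1]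
    simp only [hg, hD, Finset.sum_sub_distrib]
    rfl
  have hsum : ∀ ε : Fin n → Bool,
      MemLp (fun z : Fin n → 𝒳 × 𝒳 => radSum (fun j => D (z j)) ε) p ν := fun ε =>
    memLp_finsetSum _ fun j _ =>
      (hDL.comp_measurePreserving (measurePreserving_eval (fun _ => P.prod P) j)).const_smul _
  have h3 : ∀ ε : Fin n → Bool,
      ∫ z, ‖∑ j, D (z j)‖ ^ p ∂ν = ∫ z, ‖radSum (fun j => D (z j)) ε‖ ^ p ∂ν := by
    intro ε
    rw [← integral_comp_measurePreserving (measurePreserving_signSwap (P := P) ε)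
      (((memLp_sum_pi hDL n).integrable_norm_pow hp0).1)]
    refine integral_congr_ae (Filter.Eventually.of_forall fun z => ?_)
    simp only [radSum]
    congr 2
    refine Finset.sum_congr rfl fun j _ => ?_
    cases ε j <;> simp [hD, sgn]
  have hint : Integrable (fun z : Fin n → 𝒳 × 𝒳 => ∑ j, ‖D (z j)‖ ^ p) ν :=
    integrable_finsetSum _ fun j _ => integrable_eval_pi hDint j
  have h4 : ∫ z, ‖∑ j, D (z j)‖ ^ p ∂ν
      = ∫ z, signAvg (fun ε => ‖radSum (fun j => D (z j)) ε‖ ^ p) ∂ν := by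
    simp only [signAvg, smul_eq_mul]
    rw [integral_const_mul, integral_finsetSum _ fun ε _ => (hsum ε).integrable_norm_pow hp0]
    simp only [← h3]
    simp
  have h5 : ∀ z : Fin n → 𝒳 × 𝒳, signAvg (fun ε => ‖radSum (fun j => D (z j)) ε‖ ^ p)
      ≤ K * (n : ℝ) ^ (k - 1) * ∑ j, ‖D (z j)‖ ^ p := by
    intro z
    refine (hK _).trans ?_
    rw [mul_assoc]
    gcongr
    -- Power mean inequality: the k-th power of the sum of the n squares costs n^(k-1).
    obtain ⟨k', rfl⟩ : ∃ k', k = k' + 1 := ⟨k - 1, by omega⟩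
    have h := pow_sum_le_card_mul_sum_pow (s := Finset.univ) (f := fun j => ‖D (z j)‖ ^ 2)
      (fun j _ => sq_nonneg _) k'
    simpa [← pow_mul, hp] using h
  have h6 : ∫ z, ‖D z‖ ^ p ∂(P.prod P) ≤ 4 ^ k * ∫ x, ‖Y x‖ ^ p ∂P := by
    have hYint := hY.integrable_norm_pow hp0
    have e1 : ∫ z : 𝒳 × 𝒳, ‖Y z.1‖ ^ p ∂(P.prod P) = ∫ x, ‖Y x‖ ^ p ∂P :=
      integral_comp_measurePreserving measurePreserving_fst hYint.1
    have e2 : ∫ z : 𝒳 × 𝒳, ‖Y z.2‖ ^ p ∂(P.prod P) = ∫ x, ‖Y x‖ ^ p ∂P :=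
      integral_comp_measurePreserving measurePreserving_snd hYint.1
    calc ∫ z, ‖D z‖ ^ p ∂(P.prod P)
        ≤ ∫ z : 𝒳 × 𝒳, 2 ^ (p - 1) * (‖Y z.1‖ ^ p + ‖Y z.2‖ ^ p) ∂(P.prod P) := by
          refine integral_mono hDint (((hYint.comp_fst P).add (hYint.comp_snd P)).const_mul _)
            fun z => ?_
          refine (pow_le_pow_left₀ (norm_nonneg _) (norm_sub_le _ _) p).trans ?_
          exact add_pow_le (norm_nonneg _) (norm_nonneg _) p
      _ = 4 ^ k * ∫ x, ‖Y x‖ ^ p ∂P := by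
          rw [integral_const_mul, integral_add (hYint.comp_fst P) (hYint.comp_snd P), e1, e2,
            ← two_mul, ← mul_assoc, ← pow_succ, show p - 1 + 1 = 2 * k by omega, pow_mul]
          norm_num
  have h7 : ∫ z, ∑ j, ‖D (z j)‖ ^ p ∂ν = n * ∫ z, ‖D z‖ ^ p ∂(P.prod P) :=
    integral_sum_pi hDint n
  calc ∫ x, ‖g x‖ ^ p ∂μ ≤ ∫ z, ‖∑ j, D (z j)‖ ^ p ∂ν := h1.trans_eq h2
    _ ≤ ∫ z, K * (n : ℝ) ^ (k - 1) * ∑ j, ‖D (z j)‖ ^ p ∂ν := by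
        rw [h4]
        refine integral_mono ?_ (hint.const_mul _) h5
        simp only [signAvg, smul_eq_mul]
        exact (integrable_finsetSum _ fun ε _ => (hsum ε).integrable_norm_pow hp0).const_mul _
    _ = K * (n : ℝ) ^ (k - 1) * (n * ∫ z, ‖D z‖ ^ p ∂(P.prod P)) := by
        rw [integral_const_mul, h7]
    _ ≤ K * (n : ℝ) ^ (k - 1) * (n * (4 ^ k * ∫ x, ‖Y x‖ ^ p ∂P)) := by gcongr
    _ = _ := by
        conv_rhs => rw [show k = k - 1 + 1 by omega, pow_succ (n : ℝ)]
        rw [show k - 1 + 1 = k by omega]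
        ring

lemma integrable_inner_of_memLp {α V : Type*} [MeasurableSpace α] {μ : Measure α}
    [NormedAddCommGroup V] [InnerProductSpace ℝ V] {u v : α → V} (hu : MemLp u 2 μ)
    (hv : MemLp v 2 μ) : Integrable (fun x => inner ℝ (u x) (v x)) μ :=
  (hu.norm.integrable_mul hv.norm).mono' (hu.1.inner hv.1)
    (Filter.Eventually.of_forall fun x => norm_inner_le_norm (u x) (v x))

/-- Orthogonality of independent centered variables. In contrast to symmetrization it is exact,
which keeps the coefficient of σ² / (nm) equal to 2. -/
lemma integral_norm_sum_sq {V : Type*} [NormedAddCommGroup V] [InnerProductSpace ℝ V]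
    [CompleteSpace V] {Y : 𝒳 → V} (hY : MemLp Y 2 P) (h0 : ∫ x, Y x ∂P = 0) (n : ℕ) :
    ∫ x : Fin n → 𝒳, ‖∑ j, Y (x j)‖ ^ 2 ∂(Measure.pi fun _ => P) = n * ∫ x, ‖Y x‖ ^ 2 ∂P := by
  have hY1 : Integrable Y P := hY.integrable (by norm_num)
  have hY2 : ∀ j : Fin n, MemLp (fun x : Fin n → 𝒳 => Y (x j)) 2 (Measure.pi fun _ => P) :=
    fun j => hY.comp_measurePreserving (measurePreserving_eval (fun _ => P) j)
  have hii : iIndepFun (fun (j : Fin n) (x : Fin n → 𝒳) => x j) (Measure.pi fun _ => P) :=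
    iIndepFun_pi (X := fun _ => id) fun _ => aemeasurable_id
  have hcross : ∀ i j : Fin n, i ≠ j →
      ∫ x : Fin n → 𝒳, inner ℝ (Y (x i)) (Y (x j)) ∂(Measure.pi fun _ => P) = 0 := by
    intro i j hij
    have hmap : ∀ j : Fin n, (Measure.pi fun _ : Fin n => P).map (fun x => x j) = P :=
      fun j => (measurePreserving_eval (fun _ => P) j).map_eq
    have h : ∫ x : Fin n → 𝒳, inner ℝ (Y (x i)) (Y (x j)) ∂(Measure.pi fun _ => P)
        = inner ℝ (∫ x : Fin n → 𝒳, Y (x i) ∂(Measure.pi fun _ => P))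
          (∫ x : Fin n → 𝒳, Y (x j) ∂(Measure.pi fun _ => P)) :=
      (hii.indepFun hij).integral_bilin_comp_comp (f := Y) (g := Y)
      (measurable_pi_apply i).aemeasurable (measurable_pi_apply j).aemeasurable
      (by rwa [hmap]) (by rwa [hmap]) (innerSL ℝ)
    rw [h, integral_eval_pi hY1.1, h0, inner_zero_left]
  have hint : ∀ i j : Fin n, Integrable (fun x : Fin n → 𝒳 => inner ℝ (Y (x i)) (Y (x j)))
      (Measure.pi fun _ => P) := fun i j => integrable_inner_of_memLp (hY2 i) (hY2 j)
  simp_rw [← real_inner_self_eq_norm_sq, sum_inner, inner_sum]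
  rw [integral_finsetSum _ fun i _ => integrable_finsetSum _ fun j _ => hint i j]
  have : ∀ i : Fin n, ∫ x : Fin n → 𝒳, ∑ j, inner ℝ (Y (x i)) (Y (x j)) ∂(Measure.pi fun _ => P)
      = ∫ x, inner ℝ (Y x) (Y x) ∂P := by
    intro i
    rw [integral_finsetSum _ fun j _ => hint i j,
      Finset.sum_eq_single i (fun j _ hji => hcross i j hji.symm) (by simp)]
    exact integral_eval_pi (Y := fun x => inner ℝ (Y x) (Y x)) (integrable_inner_of_memLp hY hY).1 i
  simp [this]

end Symmetrization

/-! ### Minimizers of convex functions with a well-conditioned Hessian -/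

section Deterministic

set_option linter.unusedSectionVars false

variable {E : Type*} [NormedAddCommGroup E] [InnerProductSpace ℝ E]

/-- `A` is bounded below by `lam` as a quadratic form. -/
def Coercive (lam : ℝ) (A : E →L[ℝ] E) : Prop := ∀ v, lam * ‖v‖ ^ 2 ≤ inner ℝ (A v) v

lemma Coercive.norm_le {lam : ℝ} {A : E →L[ℝ] E} (hA : Coercive lam A) (v : E) :
    lam * ‖v‖ ≤ ‖A v‖ := by
  rcases eq_or_ne v 0 with rfl | hv
  · simp
  have hv' : 0 < ‖v‖ := norm_pos_iff.2 hv
  refine le_of_mul_le_mul_right ?_ hv'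
  calc lam * ‖v‖ * ‖v‖ = lam * ‖v‖ ^ 2 := by ring
    _ ≤ inner ℝ (A v) v := hA v
    _ ≤ _ := real_inner_le_norm _ _

/-- `ContinuousLinearMap.inverse` is 0 by default on operators without an inverse, so invertibility
must be known before it is used. In finite dimension, injectivity suffices. -/
lemma Coercive.exists_equiv [FiniteDimensional ℝ E] {lam : ℝ} (hlam : 0 < lam)
    {A : E →L[ℝ] E} (hA : Coercive lam A) : ∃ e : E ≃L[ℝ] E, (e : E →L[ℝ] E) = A := by
  have hinj : Function.Injective (A : E →ₗ[ℝ] E) := by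
    rw [← LinearMap.ker_eq_bot, LinearMap.ker_eq_bot']
    intro v hv
    have h := hA.norm_le v
    have hv' : A v = 0 := hv
    rw [hv', norm_zero] at h
    have : ‖v‖ ≤ 0 := by nlinarith [norm_nonneg v]
    exact norm_le_zero_iff.1 this
  refine ⟨(LinearEquiv.ofInjectiveEndo (A : E →ₗ[ℝ] E) hinj).toContinuousLinearEquiv, ?_⟩
  ext v
  simp

lemma Coercive.inverse_apply_apply [FiniteDimensional ℝ E] {lam : ℝ} (hlam : 0 < lam)
    {A : E →L[ℝ] E} (hA : Coercive lam A) (v : E) : A.inverse (A v) = v := by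
  obtain ⟨e, rfl⟩ := hA.exists_equiv hlam
  simp

lemma Coercive.norm_inverse_apply_le [FiniteDimensional ℝ E] {lam : ℝ} (hlam : 0 < lam)
    {A : E →L[ℝ] E} (hA : Coercive lam A) (v : E) : ‖A.inverse v‖ ≤ ‖v‖ / lam := by
  have h := hA.norm_le (A.inverse v)
  obtain ⟨e, rfl⟩ := hA.exists_equiv hlam
  rw [le_div_iff₀ hlam, mul_comm]
  simpa using h

variable [CompleteSpace E]

/-- By convexity, the difference quotients along the segment from x to y are at most F y - F x ≤ 0.
-/
lemma inner_gradient_nonpos_of_convexOn {F : E → ℝ} {Θ : Set E} (hF : ConvexOn ℝ Θ F)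
    {x y g : E} (hx : x ∈ Θ) (hy : y ∈ Θ) (hg : HasGradientAt F g x) (hle : F y ≤ F x) :
    inner ℝ g (y - x) ≤ 0 := by
  have hline : HasDerivAt (fun s : ℝ => x + s • (y - x)) (y - x) 0 := by
    simpa using ((hasDerivAt_id (0 : ℝ)).smul_const (y - x)).const_add x
  have hg' : HasFDerivAt F (InnerProductSpace.toDual ℝ E g) (x + (0 : ℝ) • (y - x)) := by
    simpa using hg.hasFDerivAt
  have hd : HasDerivAt (fun s : ℝ => F (x + s • (y - x))) (inner ℝ g (y - x)) 0 := by
    simpa [Function.comp_def] using hg'.comp_hasDerivAt (0 : ℝ) hline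
  have ht := hd.hasDerivWithinAt (s := Set.Ioi 0)
  rw [hasDerivWithinAt_iff_tendsto_slope' (by simp)] at ht
  refine le_of_tendsto ht ?_
  filter_upwards [Ioo_mem_nhdsGT (show (0 : ℝ) < 1 by norm_num)] with s hs
  have h := hF.2 hx hy (sub_nonneg.2 hs.2.le) hs.1.le (by ring)
  have e : (1 - s) • x + s • y = x + s • (y - x) := by module
  rw [e] at h
  simp only [smul_eq_mul] at h
  simp only [slope_def_field, zero_smul, add_zero, sub_zero]
  refine div_nonpos_of_nonpos_of_nonneg ?_ hs.1.le
  nlinarith [hs.1]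

/-- Mean value inequality on the closed ball of radius ‖θ - θs‖, where the derivative differs from
`A θs` by at most M‖θ - θs‖. -/
lemma norm_gradient_sub_linear_le {g : E → E} {A : E → E →L[ℝ] E} {θs : E} {ρ M : ℝ}
    (hg : ∀ θ ∈ Metric.ball θs ρ, HasFDerivAt g (A θ) θ) (hM : 0 ≤ M)
    (hA : ∀ θ ∈ Metric.ball θs ρ, ‖A θ - A θs‖ ≤ M * ‖θ - θs‖) {θ : E}
    (hθ : θ ∈ Metric.ball θs ρ) :
    ‖g θ - g θs - A θs (θ - θs)‖ ≤ M * ‖θ - θs‖ ^ 2 := by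
  rw [mem_ball_iff_norm] at hθ
  have hsub : Metric.closedBall θs ‖θ - θs‖ ⊆ Metric.ball θs ρ :=
    Metric.closedBall_subset_ball hθ
  have h := (convex_closedBall θs ‖θ - θs‖).norm_image_sub_le_of_norm_hasFDerivWithin_le'
    (f := g) (f' := A) (φ := A θs) (C := M * ‖θ - θs‖) (x := θs) (y := θ)
    (fun x hx => (hg x (hsub hx)).hasFDerivWithinAt)
    (fun x hx => (hA x (hsub hx)).trans
      (mul_le_mul_of_nonneg_left (mem_closedBall_iff_norm.1 hx) hM))
    (Metric.mem_closedBall_self (norm_nonneg _)) (by simp [dist_eq_norm])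
  rwa [mul_assoc, ← sq] at h

/-- If `Q` is coercive and close to the Hessian of a convex function at `θs`, and the gradient at
`θs` is small, then a minimizer is a critical point close to `θs`. -/
lemma minimizer_near {F : E → ℝ} {g : E → E} {A : E → E →L[ℝ] E} {Θ : Set E} {θs θ₁ : E}
    {ρ M lam r : ℝ} {Q : E →L[ℝ] E} (hF : ConvexOn ℝ Θ F) (hball : Metric.ball θs ρ ⊆ Θ)
    (hgrad : ∀ θ ∈ Metric.ball θs ρ, HasGradientAt F (g θ) θ)
    (hg : ∀ θ ∈ Metric.ball θs ρ, HasFDerivAt g (A θ) θ) (hM : 0 ≤ M)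
    (hA : ∀ θ ∈ Metric.ball θs ρ, ‖A θ - A θs‖ ≤ M * ‖θ - θs‖)
    (hQ : Coercive lam Q) (hAQ : ‖A θs - Q‖ ≤ lam / 4) (hr0 : 0 < r)
    (hrρ : r < ρ) (hMr : M * r ≤ lam / 4) (hgs : ‖g θs‖ < lam * r / 4)
    (hθ₁ : θ₁ ∈ Θ) (hmin : ∀ θ ∈ Θ, F θ₁ ≤ F θ) :
    θ₁ ∈ Metric.ball θs ρ ∧ g θ₁ = 0 ∧ lam * ‖θ₁ - θs‖ ≤ 2 * ‖g θs‖ := by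
  -- Expanding the gradient at θs + u, coercivity gives λ‖u‖², while the Taylor error and A θs - Q
  -- lose at most λ‖u‖²/4 each. So (λ/2)‖u‖² ≤ ‖g θs‖‖u‖.
  have key : ∀ u : E, ‖u‖ ≤ r → inner ℝ (g (θs + u)) u ≤ 0 → lam * ‖u‖ ≤ 2 * ‖g θs‖ := by
    intro u hu hle
    rcases eq_or_ne u 0 with rfl | hu0
    · simp
    have hupos : 0 < ‖u‖ := norm_pos_iff.2 hu0
    have hmem : θs + u ∈ Metric.ball θs ρ := by
      rw [mem_ball_iff_norm]; simpa using hu.trans_lt hrρ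
    have h1 := norm_gradient_sub_linear_le hg hM hA hmem
    rw [add_sub_cancel_left] at h1
    have h2 : inner ℝ (g (θs + u)) u = inner ℝ (g (θs + u) - g θs - A θs u) u
        + inner ℝ (g θs) u + inner ℝ ((A θs - Q) u) u + inner ℝ (Q u) u := by
      simp only [inner_sub_left, sub_apply]
      ring
    have h3 := (abs_le.1 (abs_real_inner_le_norm (g (θs + u) - g θs - A θs u) u)).1
    have h4 := (abs_le.1 (abs_real_inner_le_norm (g θs) u)).1
    have h5 := (abs_le.1 (abs_real_inner_le_norm ((A θs - Q) u) u)).1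
    have h6 : ‖(A θs - Q) u‖ ≤ lam / 4 * ‖u‖ :=
      ((A θs - Q).le_opNorm u).trans (by gcongr)
    have h7 := hQ u
    have h8 : M * ‖u‖ ^ 2 ≤ lam / 4 * ‖u‖ := by
      calc M * ‖u‖ ^ 2 = M * ‖u‖ * ‖u‖ := by ring
        _ ≤ lam / 4 * ‖u‖ := by
          gcongr
          exact (mul_le_mul_of_nonneg_left hu hM).trans hMr
    have h9 := mul_le_mul_of_nonneg_right (h1.trans h8) hupos.le
    have h10 := mul_le_mul_of_nonneg_right h6 hupos.le
    refine le_of_mul_le_mul_right ?_ hupos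
    nlinarith
  -- If θ₁ were at distance at least r, the point of the segment at distance r/2 from θs would
  -- satisfy the hypothesis of `key` by convexity, forcing λr/2 ≤ 2‖g θs‖ against the smallness of
  -- the gradient.
  have hnear : ‖θ₁ - θs‖ < r := by
    by_contra! hfar
    set t := r / (2 * ‖θ₁ - θs‖) with ht
    have hpos : 0 < ‖θ₁ - θs‖ := hr0.trans_le hfar
    have ht0 : 0 < t := by positivity
    have ht1 : t ≤ 1 / 2 := by
      rw [ht, div_le_iff₀ (by positivity)]; linarith
    have hnorm : ‖t • (θ₁ - θs)‖ = r / 2 := by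
      rw [norm_smul, Real.norm_of_nonneg ht0.le, ht]; field_simp
    have hmem : θs + t • (θ₁ - θs) ∈ Metric.ball θs ρ := by
      rw [mem_ball_iff_norm, add_sub_cancel_left, hnorm]; linarith
    have h := inner_gradient_nonpos_of_convexOn hF (hball hmem) hθ₁ (hgrad _ hmem)
      (hmin _ (hball hmem))
    have e : θ₁ - (θs + t • (θ₁ - θs)) = ((1 - t) / t) • (t • (θ₁ - θs)) := by
      rw [smul_smul, div_mul_cancel₀ _ ht0.ne']; module
    rw [e, inner_smul_right] at h
    have h' := nonpos_of_mul_nonpos_right h (div_pos (by linarith) ht0)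
    have := key _ (by rw [hnorm]; linarith) h'
    rw [hnorm] at this
    linarith
  have hmem : θ₁ ∈ Metric.ball θs ρ := by
    rw [mem_ball_iff_norm]; exact hnear.trans hrρ
  have hcrit : g θ₁ = 0 := by
    have hloc : IsLocalMin F θ₁ := by
      filter_upwards [Metric.isOpen_ball.mem_nhds hmem] with θ hθ
      exact hmin θ (hball hθ)
    have h := hloc.hasFDerivAt_eq_zero (hgrad _ hmem).hasFDerivAt
    simpa using h
  refine ⟨hmem, hcrit, key _ hnear.le ?_⟩
  rw [add_sub_cancel, hcrit, inner_zero_left]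

end Deterministic

/-! ### The estimation error of a single machine, dataset by dataset -/

section Expansion

variable {d : ℕ} {𝒳 : Type*}

/-- The average of `Y` over the dataset `s`. -/
def sampleMean {n : ℕ} {W : Type*} [AddCommGroup W] [Module ℝ W] (Y : 𝒳 → W) (s : Fin n → 𝒳) : W :=
  (1 / (n : ℝ)) • ∑ j, Y (s j)

lemma convexOn_empRisk {f : Vec d → 𝒳 → ℝ} {Θ : Set (Vec d)} (hΘ : Convex ℝ Θ)
    (hf : ∀ x, ConvexOn ℝ Θ (fun θ => f θ x)) {n : ℕ} (s : Fin n → 𝒳) :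
    ConvexOn ℝ Θ (empRisk f s) := by
  have h : ConvexOn ℝ Θ (fun θ => ∑ j, f θ (s j)) := by
    refine ⟨hΘ, fun x hx y hy a b ha hb hab => ?_⟩
    simp only [smul_eq_mul, Finset.mul_sum, ← Finset.sum_add_distrib]
    exact Finset.sum_le_sum fun j _ => (hf (s j)).2 hx hy ha hb hab
  exact h.smul (by positivity)

lemma hasGradientAt_empRisk {f : Vec d → 𝒳 → ℝ} {n : ℕ} {s : Fin n → 𝒳} {θ : Vec d}
    (h : ∀ x, DifferentiableAt ℝ (fun t => f t x) θ) :
    HasGradientAt (empRisk f s) (sampleMean (fun x => gradient (fun t => f t x) θ) s) θ := by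
  have h1 := (HasFDerivAt.fun_sum (u := Finset.univ) fun j _ =>
    (h (s j)).hasGradientAt.hasFDerivAt).const_mul (1 / (n : ℝ))
  rw [hasGradientAt_iff_hasFDerivAt]
  rw [sampleMean, map_smulₛₗ, map_sum]
  exact h1

lemma hasFDerivAt_sampleMean_gradient {f : Vec d → 𝒳 → ℝ} {n : ℕ} {s : Fin n → 𝒳} {θ : Vec d}
    (h : ∀ x, DifferentiableAt ℝ (gradient (fun t => f t x)) θ) :
    HasFDerivAt (fun θ => sampleMean (fun x => gradient (fun t => f t x) θ) s)
      (sampleMean (fun x => hess (fun t => f t x) θ) s) θ :=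
  (HasFDerivAt.fun_sum (u := Finset.univ) fun j _ => (h (s j)).hasFDerivAt).const_smul (1 / (n : ℝ))

/-- The radius of the neighbourhood of the minimizer used in the expansion. -/
def localRadius (ρ lam L : ℝ) : ℝ := min (ρ / 2) (lam / (4 * (L + 1)))

/-- The size of the empirical fluctuations below which the expansion holds. -/
def threshold (ρ lam L : ℝ) : ℝ := min 1 (min (lam / 4) (lam * localRadius ρ lam L / 8))

/-- A bound for all constants of the expansion. -/
def expansionConst (R ρ lam L : ℝ) : ℝ :=
  R / threshold ρ lam L + 2 / lam
    + (R / threshold ρ lam L ^ 2 + 1 / (lam * threshold ρ lam L)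
      + (2 / lam ^ 2 + 4 * (L + 1) / lam ^ 3))
    + (R / threshold ρ lam L ^ 3 + 1 / (lam * threshold ρ lam L ^ 2) + 4 / lam ^ 3)

lemma localRadius_pos {ρ lam L : ℝ} (hρ : 0 < ρ) (hlam : 0 < lam) (hL : 0 ≤ L) :
    0 < localRadius ρ lam L := by
  unfold localRadius; positivity

lemma threshold_pos {ρ lam L : ℝ} (hρ : 0 < ρ) (hlam : 0 < lam) (hL : 0 ≤ L) :
    0 < threshold ρ lam L := by
  have := localRadius_pos hρ hlam hL
  unfold threshold; positivity

/-- Sum of the fluctuations of the gradient, the Hessian and its Lipschitz modulus. -/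
def fluctuation [MeasurableSpace 𝒳] (f : Vec d → 𝒳 → ℝ) (P : Measure 𝒳) (θs : Vec d)
    (lip : 𝒳 → ℝ) {n : ℕ} (s : Fin n → 𝒳) : ℝ :=
  ‖sampleMean (fun x => gradient (fun t => f t x) θs) s‖
    + ‖sampleMean (fun x => hess (fun t => f t x) θs - hess (popRisk f P) θs) s‖
    + ‖sampleMean (fun x => lip x - ∫ y, lip y ∂P) s‖

lemma sampleMean_sub_const {n : ℕ} (hn : 0 < n) {W : Type*} [AddCommGroup W] [Module ℝ W]
    (Y : 𝒳 → W) (w : W) (s : Fin n → 𝒳) :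
    sampleMean (fun x => Y x - w) s = sampleMean Y s - w := by
  have : (n : ℝ) ≠ 0 := by exact_mod_cast hn.ne'
  simp only [sampleMean, Finset.sum_sub_distrib, smul_sub, Finset.sum_const, Finset.card_univ,
    Fintype.card_fin]
  rw [← Nat.cast_smul_eq_nsmul ℝ, smul_smul, one_div_mul_cancel this, one_smul]

variable [MeasurableSpace 𝒳]

/-- The second order expansion of the empirical minimizer, when the fluctuations are small. -/
lemma expansion_of_small {f : Vec d → 𝒳 → ℝ} {P : Measure 𝒳} {Θ : Set (Vec d)} {θs θ₁ : Vec d}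
    {ρ lam L : ℝ} {lip : 𝒳 → ℝ} (hρ : 0 < ρ) (hlam : 0 < lam) (hL : 0 ≤ L)
    (hΘ : Convex ℝ Θ) (hconv : ∀ x, ConvexOn ℝ Θ (fun θ => f θ x))
    (hball : Metric.ball θs ρ ⊆ Θ)
    (htd : ∀ x, TwiceDiffOn (fun θ => f θ x) (Metric.ball θs ρ))
    (hlip : ∀ x, ∀ θ ∈ Metric.ball θs ρ, ∀ θ' ∈ Metric.ball θs ρ,
      ‖hess (fun t => f t x) θ' - hess (fun t => f t x) θ‖ ≤ lip x * ‖θ' - θ‖)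
    (hlipL : |∫ y, lip y ∂P| ≤ L) (hQ : Coercive lam (hess (popRisk f P) θs))
    {n : ℕ} (hn : 0 < n) {s : Fin n → 𝒳} (hmin : IsEmpMin f Θ s θ₁)
    (hsmall : fluctuation f P θs lip s < threshold ρ lam L) :
    lam * ‖θ₁ - θs‖ ≤ 2 * ‖sampleMean (fun x => gradient (fun t => f t x) θs) s‖ ∧
    lam * ‖θ₁ - θs + (hess (popRisk f P) θs).inverse
        (sampleMean (fun x => gradient (fun t => f t x) θs) s)‖
      ≤ ‖sampleMean (fun x => hess (fun t => f t x) θs - hess (popRisk f P) θs) s‖ * ‖θ₁ - θs‖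
        + (L + ‖sampleMean (fun x => lip x - ∫ y, lip y ∂P) s‖) * ‖θ₁ - θs‖ ^ 2 := by
  set Q := hess (popRisk f P) θs with hQdef
  set g : Vec d → Vec d := fun θ => sampleMean (fun x => gradient (fun t => f t x) θ) s with hg
  set A : Vec d → Vec d →L[ℝ] Vec d := fun θ => sampleMean (fun x => hess (fun t => f t x) θ) s
    with hA
  set l := ‖sampleMean (fun x => lip x - ∫ y, lip y ∂P) s‖ with hl
  have hr := localRadius_pos hρ hlam hL
  have hAQ : sampleMean (fun x => hess (fun t => f t x) θs - Q) s = A θs - Q :=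
    sampleMean_sub_const hn _ _ _
  have hflu : ‖g θs‖ + ‖A θs - Q‖ + l < threshold ρ lam L := by
    rw [← hAQ]; exact hsmall
  have h1 : threshold ρ lam L ≤ 1 := min_le_left _ _
  have h2 : threshold ρ lam L ≤ lam / 4 := (min_le_right _ _).trans (min_le_left _ _)
  have h3 : threshold ρ lam L ≤ lam * localRadius ρ lam L / 8 :=
    (min_le_right _ _).trans (min_le_right _ _)
  have hg0 := norm_nonneg (g θs)
  have hA0 := norm_nonneg (A θs - Q)
  have hl0 : 0 ≤ l := norm_nonneg _
  have hLl : |sampleMean lip s| ≤ L + l := by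
    have e := sampleMean_sub_const hn lip (∫ y, lip y ∂P) s
    rw [hl, e, Real.norm_eq_abs]
    have := abs_add_le (∫ y, lip y ∂P) (sampleMean lip s - ∫ y, lip y ∂P)
    rw [add_sub_cancel] at this
    linarith
  have hself : θs ∈ Metric.ball θs ρ := Metric.mem_ball_self hρ
  have hAlip : ∀ θ ∈ Metric.ball θs ρ, ‖A θ - A θs‖ ≤ (L + l) * ‖θ - θs‖ := by
    intro θ hθ
    have e : A θ - A θs
        = (1 / (n : ℝ)) • ∑ j, (hess (fun t => f t (s j)) θ - hess (fun t => f t (s j)) θs) := by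
      simp only [hA, sampleMean, Finset.sum_sub_distrib, smul_sub]
    rw [e, norm_smul, Real.norm_of_nonneg (by positivity)]
    calc 1 / (n : ℝ) * ‖∑ j, (hess (fun t => f t (s j)) θ - hess (fun t => f t (s j)) θs)‖
        ≤ 1 / (n : ℝ) * ∑ j, lip (s j) * ‖θ - θs‖ := by
          gcongr
          exact norm_sum_le_of_le _ fun j _ => hlip (s j) θs hself θ hθ
      _ = sampleMean lip s * ‖θ - θs‖ := by
          rw [← Finset.sum_mul, sampleMean, smul_eq_mul, mul_assoc]
      _ ≤ (L + l) * ‖θ - θs‖ := by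
          gcongr
          exact (le_abs_self _).trans hLl
  have hgrad : ∀ θ ∈ Metric.ball θs ρ, HasGradientAt (empRisk f s) (g θ) θ :=
    fun θ hθ => hasGradientAt_empRisk fun x => (htd x θ hθ).1
  have hder : ∀ θ ∈ Metric.ball θs ρ, HasFDerivAt g (A θ) θ :=
    fun θ hθ => hasFDerivAt_sampleMean_gradient fun x => (htd x θ hθ).2
  have hM : 0 ≤ L + l := by positivity
  have hMr : (L + l) * localRadius ρ lam L ≤ lam / 4 := by
    calc (L + l) * localRadius ρ lam L ≤ (L + 1) * (lam / (4 * (L + 1))) := by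
          gcongr
          · linarith
          · exact min_le_right _ _
      _ = lam / 4 := by field_simp
  -- Each part of the threshold serves one hypothesis: 1 bounds l, hence the Lipschitz constant L +
  -- l on the local radius; λ/4 bounds A θs - Q; the last one bounds the gradient.
  obtain ⟨hmem, hcrit, hdist⟩ := minimizer_near (convexOn_empRisk hΘ hconv s) hball hgrad hder hM
    hAlip hQ (by linarith) hr ((min_le_left _ _).trans_lt (by linarith)) hMr
    (by nlinarith [mul_pos hlam hr]) hmin.1 hmin.2
  refine ⟨hdist, ?_⟩
  have hrem := norm_gradient_sub_linear_le hder hM hAlip hmem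
  rw [hcrit] at hrem
  set Δ := θ₁ - θs with hΔ
  -- Since the gradient vanishes at θ₁, the Taylor remainder is 0 - g θs - A θs Δ; replacing A θs by
  -- Q and inverting Q isolates Δ.
  have e : Δ + Q.inverse (g θs) = -Q.inverse ((0 - g θs - A θs Δ) + (A θs - Q) Δ) := by
    have h := hQ.inverse_apply_apply hlam Δ
    simp only [map_add, map_sub, map_zero, sub_apply, h]
    abel
  rw [hAQ, e, norm_neg]
  calc lam * ‖Q.inverse ((0 - g θs - A θs Δ) + (A θs - Q) Δ)‖
      ≤ lam * (‖(0 - g θs - A θs Δ) + (A θs - Q) Δ‖ / lam) := by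
        gcongr
        exact hQ.norm_inverse_apply_le hlam _
    _ = ‖(0 - g θs - A θs Δ) + (A θs - Q) Δ‖ := mul_div_cancel₀ _ hlam.ne'
    _ ≤ (L + l) * ‖Δ‖ ^ 2 + ‖A θs - Q‖ * ‖Δ‖ :=
        (norm_add_le _ _).trans (add_le_add hrem ((A θs - Q).le_opNorm Δ))
    _ = _ := add_comm _ _

/-- The expansion with remainders that are valid for all datasets. -/
lemma expansion_bounds {f : Vec d → 𝒳 → ℝ} {P : Measure 𝒳} {Θ : Set (Vec d)} {θs θ₁ : Vec d}
    {R ρ lam L : ℝ} {lip : 𝒳 → ℝ} (hρ : 0 < ρ) (hlam : 0 < lam) (hL : 0 ≤ L)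
    (hΘ : Convex ℝ Θ) (hconv : ∀ x, ConvexOn ℝ Θ (fun θ => f θ x))
    (hball : Metric.ball θs ρ ⊆ Θ)
    (htd : ∀ x, TwiceDiffOn (fun θ => f θ x) (Metric.ball θs ρ))
    (hlip : ∀ x, ∀ θ ∈ Metric.ball θs ρ, ∀ θ' ∈ Metric.ball θs ρ,
      ‖hess (fun t => f t x) θ' - hess (fun t => f t x) θ‖ ≤ lip x * ‖θ' - θ‖)
    (hlipL : |∫ y, lip y ∂P| ≤ L) (hQ : Coercive lam (hess (popRisk f P) θs))
    {n : ℕ} (hn : 0 < n) {s : Fin n → 𝒳} (hmin : IsEmpMin f Θ s θ₁)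
    (hR : ‖θ₁ - θs‖ ≤ R) :
    ‖θ₁ - θs‖ ≤ expansionConst R ρ lam L * fluctuation f P θs lip s ∧
    ‖θ₁ - θs + (hess (popRisk f P) θs).inverse
        (sampleMean (fun x => gradient (fun t => f t x) θs) s)‖
      ≤ expansionConst R ρ lam L * fluctuation f P θs lip s ^ 2 ∧
    ‖θ₁ - θs + (hess (popRisk f P) θs).inverse
        (sampleMean (fun x => gradient (fun t => f t x) θs) s)‖
      ≤ (‖sampleMean (fun x => hess (fun t => f t x) θs - hess (popRisk f P) θs) s‖
          + 2 * L / lam * ‖sampleMean (fun x => gradient (fun t => f t x) θs) s‖) / lam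
          * ‖θ₁ - θs‖
        + expansionConst R ρ lam L * fluctuation f P θs lip s ^ 3 := by
  have hexp := expansion_of_small hρ hlam hL hΘ hconv hball htd hlip hlipL hQ hn hmin
  have hinv := hQ.norm_inverse_apply_le hlam (sampleMean (fun x => gradient (fun t => f t x) θs) s)
  have hτ1 : threshold ρ lam L ≤ 1 := min_le_left _ _
  have hτ := threshold_pos hρ hlam hL
  have hR0 : 0 ≤ R := (norm_nonneg _).trans hR
  unfold expansionConst
  set Δ := θ₁ - θs
  set v := (hess (popRisk f P) θs).inverse
    (sampleMean (fun x => gradient (fun t => f t x) θs) s)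
  set a := ‖sampleMean (fun x => gradient (fun t => f t x) θs) s‖
  set p := ‖sampleMean (fun x => hess (fun t => f t x) θs - hess (popRisk f P) θs) s‖
  set l := ‖sampleMean (fun x => lip x - ∫ y, lip y ∂P) s‖
  set t := fluctuation f P θs lip s with ht
  have ht' : t = a + p + l := rfl
  set τ := threshold ρ lam L
  have ha : 0 ≤ a := norm_nonneg _
  have hp : 0 ≤ p := norm_nonneg _
  have hl : 0 ≤ l := norm_nonneg _
  have hδ : 0 ≤ ‖Δ‖ := norm_nonneg _
  have ht0 : 0 ≤ t := by rw [ht']; positivity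
  set K1 := R / τ + 2 / lam with hK1
  set K2 := R / τ ^ 2 + 1 / (lam * τ) + (2 / lam ^ 2 + 4 * (L + 1) / lam ^ 3) with hK2
  set K3 := R / τ ^ 3 + 1 / (lam * τ ^ 2) + 4 / lam ^ 3 with hK3
  have hK1' : 0 ≤ K1 := by positivity
  have hK2' : 0 ≤ K2 := by positivity
  have hK3' : 0 ≤ K3 := by positivity
  suffices h : ‖Δ‖ ≤ K1 * t ∧ ‖Δ + v‖ ≤ K2 * t ^ 2 ∧
      ‖Δ + v‖ ≤ (p + 2 * L / lam * a) / lam * ‖Δ‖ + K3 * t ^ 3 by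
    refine ⟨h.1.trans ?_, h.2.1.trans ?_, h.2.2.trans ?_⟩ <;> gcongr <;> linarith
  rcases lt_or_ge t τ with hsmall | hlarge
  · obtain ⟨h1, h2⟩ := hexp hsmall
    have hd : ‖Δ‖ ≤ 2 / lam * a := by
      rw [div_mul_eq_mul_div, le_div_iff₀ hlam]; linarith
    have hdt : ‖Δ‖ ≤ 2 / lam * t := hd.trans (by gcongr; linarith)
    have hv : ‖Δ + v‖ ≤ (p * ‖Δ‖ + (L + l) * ‖Δ‖ ^ 2) / lam := by
      rw [le_div_iff₀ hlam]; linarith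
    refine ⟨hdt.trans ?_, hv.trans ?_, hv.trans ?_⟩
    · gcongr; rw [hK1]; linarith [div_nonneg hR0 hτ.le]
    · calc (p * ‖Δ‖ + (L + l) * ‖Δ‖ ^ 2) / lam
          ≤ (t * (2 / lam * t) + (L + 1) * (2 / lam * t) ^ 2) / lam := by
            gcongr <;> linarith
        _ = (2 / lam ^ 2 + 4 * (L + 1) / lam ^ 3) * t ^ 2 := by field_simp; ring
        _ ≤ K2 * t ^ 2 := by
            gcongr
            rw [hK2]
            have : 0 ≤ R / τ ^ 2 + 1 / (lam * τ) := by positivity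
            linarith
    -- Only the term with l becomes cubic in t. The other two keep one factor ‖Δ‖, so that the mean
    -- square of Δ can be inserted later.
    · calc (p * ‖Δ‖ + (L + l) * ‖Δ‖ ^ 2) / lam
          = (p * ‖Δ‖ + L * ‖Δ‖ * ‖Δ‖ + l * ‖Δ‖ ^ 2) / lam := by ring
        _ ≤ (p * ‖Δ‖ + L * (2 / lam * a) * ‖Δ‖ + t * (2 / lam * t) ^ 2) / lam := by
            gcongr
            linarith
        _ = (p + 2 * L / lam * a) / lam * ‖Δ‖ + 4 / lam ^ 3 * t ^ 3 := by field_simp; ring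
        _ ≤ _ := by
            gcongr
            rw [hK3]
            have : 0 ≤ R / τ ^ 3 + 1 / (lam * τ ^ 2) := by positivity
            linarith
  -- Large fluctuations: t/τ ≥ 1, so the trivial bounds may be multiplied by any power of t/τ.
  · have hone : 1 ≤ t / τ := (one_le_div hτ).2 hlarge
    have hRk : ∀ k : ℕ, R ≤ R / τ ^ k * t ^ k := by
      intro k
      rw [div_mul_eq_mul_div, mul_div_assoc, ← div_pow]
      exact le_mul_of_one_le_right hR0 (one_le_pow₀ hone)
    have htk : ∀ k : ℕ, t / lam ≤ 1 / (lam * τ ^ k) * t ^ (k + 1) := by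
      intro k
      have e : 1 / (lam * τ ^ k) * t ^ (k + 1) = t / lam * (t / τ) ^ k := by
        rw [div_pow]; field_simp; ring
      rw [e]
      exact le_mul_of_one_le_right (by positivity) (one_le_pow₀ hone)
    have hvb : ‖Δ + v‖ ≤ R + t / lam := by
      refine (norm_add_le _ _).trans (add_le_add hR (hinv.trans ?_))
      gcongr; linarith
    refine ⟨?_, hvb.trans ?_, hvb.trans ?_⟩
    · have h1 := hRk 1
      simp only [pow_one] at h1
      have : 0 ≤ 2 / lam * t := by positivity
      rw [hK1, add_mul]; linarith
    · have h1 := hRk 2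
      have h2 := htk 1
      simp only [pow_one] at h2
      have : 0 ≤ (2 / lam ^ 2 + 4 * (L + 1) / lam ^ 3) * t ^ 2 := by positivity
      rw [hK2, add_mul, add_mul]; linarith
    · have h1 := hRk 3
      have h2 := htk 2
      have h3 : 0 ≤ 4 / lam ^ 3 * t ^ 3 := by positivity
      have h4 : 0 ≤ (p + 2 * L / lam * a) / lam * ‖Δ‖ := by positivity
      rw [hK3, add_mul, add_mul]; linarith

end Expansion

/-! ### Differentiation of the population risk -/

section PopulationRisk

variable {d : ℕ} {𝒳 : Type*} [MeasurableSpace 𝒳]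

/-- An envelope, uniform over the ball, built from data at the center only; it serves as the
dominating function for differentiation under the integral. -/
lemma norm_gradient_le {F : Vec d → ℝ} {θs : Vec d} {ρ ℓ : ℝ}
    (htd : TwiceDiffOn F (Metric.ball θs ρ))
    (hlip : ∀ θ ∈ Metric.ball θs ρ, ‖hess F θ - hess F θs‖ ≤ ℓ * ‖θ - θs‖) {θ : Vec d}
    (hθ : θ ∈ Metric.ball θs ρ) :
    ‖gradient F θ‖ ≤ ‖gradient F θs‖ + (‖hess F θs‖ + |ℓ| * ρ) * ρ := by
  have hρ : 0 < ρ := Metric.pos_of_mem_ball hθ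
  have hself : θs ∈ Metric.ball θs ρ := Metric.mem_ball_self hρ
  have hb : ∀ x ∈ Metric.ball θs ρ, ‖hess F x‖ ≤ ‖hess F θs‖ + |ℓ| * ρ := by
    intro x hx
    have h1 := norm_le_norm_add_norm_sub' (hess F x) (hess F θs)
    have h2 : ‖hess F x - hess F θs‖ ≤ |ℓ| * ρ := by
      refine (hlip x hx).trans ?_
      have := (mem_ball_iff_norm.1 hx).le
      calc ℓ * ‖x - θs‖ ≤ |ℓ| * ‖x - θs‖ := by gcongr; exact le_abs_self _
        _ ≤ _ := by gcongr
    linarith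
  have h := (convex_ball θs ρ).norm_image_sub_le_of_norm_hasFDerivWithin_le
    (f := gradient F) (f' := hess F) (fun x hx => (htd x hx).2.hasFDerivAt.hasFDerivWithinAt)
    hb hself hθ
  have h1 := norm_le_norm_add_norm_sub' (gradient F θ) (gradient F θs)
  have h2 : (‖hess F θs‖ + |ℓ| * ρ) * ‖θ - θs‖ ≤ (‖hess F θs‖ + |ℓ| * ρ) * ρ := by
    gcongr
    exact (mem_ball_iff_norm.1 hθ).le
  linarith

/-- Integrability of the derivatives of the losses, which is all that differentiation under the
integral sign needs. -/
structure DominatedLoss (f : Vec d → 𝒳 → ℝ) (P : Measure 𝒳) (θs : Vec d) (ρ : ℝ) (lip : 𝒳 → ℝ) :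
    Prop where
  twiceDiff : ∀ x, TwiceDiffOn (fun θ => f θ x) (Metric.ball θs ρ)
  lipschitz : ∀ x, ∀ θ ∈ Metric.ball θs ρ,
    ‖hess (fun t => f t x) θ - hess (fun t => f t x) θs‖ ≤ lip x * ‖θ - θs‖
  integrable_lip : Integrable lip P
  integrable_loss : ∀ θ ∈ Metric.ball θs ρ, Integrable (f θ) P
  integrable_grad : ∀ θ ∈ Metric.ball θs ρ, Integrable (fun x => gradient (fun t => f t x) θ) P
  integrable_hess : Integrable (fun x => hess (fun t => f t x) θs) P

variable {f : Vec d → 𝒳 → ℝ} {P : Measure 𝒳} {θs : Vec d} {ρ : ℝ}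
  {lip : 𝒳 → ℝ}

lemma DominatedLoss.hasGradientAt (h : DominatedLoss f P θs ρ lip) {θ : Vec d}
    (hθ : θ ∈ Metric.ball θs ρ) :
    HasGradientAt (popRisk f P) (∫ x, gradient (fun t => f t x) θ ∂P) θ := by
  have hρ : 0 < ρ := Metric.pos_of_mem_ball hθ
  have hself : θs ∈ Metric.ball θs ρ := Metric.mem_ball_self hρ
  have hnhds := Metric.isOpen_ball.mem_nhds hθ
  have key := hasFDerivAt_integral_of_dominated_of_fderiv_le (𝕜 := ℝ) (μ := P) (F := f)
    (F' := fun θ x => InnerProductSpace.toDual ℝ (Vec d) (gradient (fun t => f t x) θ))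
    (bound := fun x => ‖gradient (fun t => f t x) θs‖
      + (‖hess (fun t => f t x) θs‖ + |lip x| * ρ) * ρ)
    hnhds
    (by filter_upwards [hnhds] with θ hθ using (h.integrable_loss θ hθ).1)
    (h.integrable_loss θ hθ)
    ((InnerProductSpace.toDual ℝ (Vec d)).continuous.comp_aestronglyMeasurable
      (h.integrable_grad θ hθ).1)
    (Filter.Eventually.of_forall fun x θ hθ => by
      rw [LinearIsometryEquiv.norm_map]
      exact norm_gradient_le (h.twiceDiff x) (h.lipschitz x) hθ)
    ((h.integrable_grad θs hself).norm.add
      (((h.integrable_hess.norm.add (h.integrable_lip.abs.mul_const ρ))).mul_const ρ))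
    (Filter.Eventually.of_forall fun x θ hθ =>
      ((h.twiceDiff x θ hθ).1.hasGradientAt).hasFDerivAt)
  rw [hasGradientAt_iff_hasFDerivAt]
  have e : InnerProductSpace.toDual ℝ (Vec d) (∫ x, gradient (fun t => f t x) θ ∂P)
      = ∫ x, InnerProductSpace.toDual ℝ (Vec d) (gradient (fun t => f t x) θ) ∂P :=
    (ContinuousLinearMap.integral_comp_comm (𝕜 := ℝ) (innerSL ℝ) (h.integrable_grad θ hθ)).symm
  rw [e]
  exact key

/-- Makes the Hessian fluctuation centered, as symmetrization requires. The gradient of the risk is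
an integral only on the ball, hence the passage to germs at θs. -/
lemma DominatedLoss.integral_hess (h : DominatedLoss f P θs ρ lip) (hρ : 0 < ρ) :
    ∫ x, hess (fun t => f t x) θs ∂P = hess (popRisk f P) θs := by
  have hself : θs ∈ Metric.ball θs ρ := Metric.mem_ball_self hρ
  have hnhds := Metric.isOpen_ball.mem_nhds hself
  have key := hasFDerivAt_integral_of_dominated_of_fderiv_le (𝕜 := ℝ) (μ := P) (x₀ := θs)
    (F := fun θ x => gradient (fun t => f t x) θ) (F' := fun θ x => hess (fun t => f t x) θ)
    (bound := fun x => ‖hess (fun t => f t x) θs‖ + |lip x| * ρ)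
    hnhds
    (by filter_upwards [hnhds] with θ hθ using (h.integrable_grad θ hθ).1)
    (h.integrable_grad θs hself) h.integrable_hess.1
    (Filter.Eventually.of_forall fun x θ hθ => by
      have h1 := norm_le_norm_add_norm_sub' (hess (fun t => f t x) θ) (hess (fun t => f t x) θs)
      have h2 : lip x * ‖θ - θs‖ ≤ |lip x| * ρ := by
        have := (mem_ball_iff_norm.1 hθ).le
        calc lip x * ‖θ - θs‖ ≤ |lip x| * ‖θ - θs‖ := by gcongr; exact le_abs_self _
          _ ≤ _ := by gcongr
      linarith [h.lipschitz x θ hθ])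
    (h.integrable_hess.norm.add (h.integrable_lip.abs.mul_const ρ))
    (Filter.Eventually.of_forall fun x θ hθ => (h.twiceDiff x θ hθ).2.hasFDerivAt)
  have hev : gradient (popRisk f P) =ᶠ[nhds θs] fun θ => ∫ x, gradient (fun t => f t x) θ ∂P := by
    filter_upwards [hnhds] with θ hθ using (h.hasGradientAt hθ).gradient
  rw [hess, hev.fderiv_eq]
  exact key.fderiv.symm

lemma DominatedLoss.integral_gradient_eq_zero (h : DominatedLoss f P θs ρ lip) (hρ : 0 < ρ)
    (hmin : IsLocalMin (popRisk f P) θs) :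
    ∫ x, gradient (fun t => f t x) θs ∂P = 0 := by
  have := hmin.hasFDerivAt_eq_zero (h.hasGradientAt (Metric.mem_ball_self hρ)).hasFDerivAt
  simpa using this

end PopulationRisk

/-! ### Moments of sample means -/

section Moments

set_option linter.unusedSectionVars false

variable {𝒳 : Type*} [MeasurableSpace 𝒳] {P : Measure 𝒳} [IsProbabilityMeasure P]

lemma norm_sampleMean {W : Type*} [NormedAddCommGroup W] [NormedSpace ℝ W] {n : ℕ} (Y : 𝒳 → W)
    (s : Fin n → 𝒳) : ‖sampleMean Y s‖ = 1 / (n : ℝ) * ‖∑ j, Y (s j)‖ := by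
  rw [sampleMean, norm_smul, Real.norm_of_nonneg (by positivity)]

lemma memLp_sampleMean {W : Type*} [NormedAddCommGroup W] [NormedSpace ℝ W] {Y : 𝒳 → W}
    {p : ENNReal} (hY : MemLp Y p P) (n : ℕ) :
    MemLp (fun s : Fin n → 𝒳 => sampleMean Y s) p (Measure.pi fun _ => P) :=
  (memLp_sum_pi hY n).const_smul (1 / (n : ℝ))

lemma integral_sampleMean {W : Type*} [NormedAddCommGroup W] [NormedSpace ℝ W] {Y : 𝒳 → W}
    (hY : Integrable Y P) {n : ℕ} (hn : 0 < n) :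
    ∫ s : Fin n → 𝒳, sampleMean Y s ∂(Measure.pi fun _ => P) = ∫ x, Y x ∂P := by
  have : (n : ℝ) ≠ 0 := by exact_mod_cast hn.ne'
  simp only [sampleMean]
  rw [integral_smul, integral_sum_pi hY, smul_smul, one_div_mul_cancel this, one_smul]

lemma integral_norm_sampleMean_pow_le {W : Type*} [NormedAddCommGroup W] [NormedSpace ℝ W]
    [CompleteSpace W] {k : ℕ} (hk : 0 < k) {K : ℝ} (hK0 : 0 ≤ K) {n : ℕ} (hn : 0 < n)
    (hK : ∀ B : Fin n → W, signAvg (fun ε => ‖radSum B ε‖ ^ (2 * k)) ≤ K * (∑ i, ‖B i‖ ^ 2) ^ k)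
    {Y : 𝒳 → W} (hY : MemLp Y (2 * k : ℕ) P) (h0 : ∫ x, Y x ∂P = 0) :
    ∫ s : Fin n → 𝒳, ‖sampleMean Y s‖ ^ (2 * k) ∂(Measure.pi fun _ => P)
      ≤ K * 4 ^ k * (∫ x, ‖Y x‖ ^ (2 * k) ∂P) / (n : ℝ) ^ k := by
  have hn' : (0 : ℝ) < n := by exact_mod_cast hn
  simp only [norm_sampleMean, mul_pow]
  rw [integral_const_mul]
  calc (1 / (n : ℝ)) ^ (2 * k) * ∫ s : Fin n → 𝒳, ‖∑ j, Y (s j)‖ ^ (2 * k)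
        ∂(Measure.pi fun _ => P)
      ≤ (1 / (n : ℝ)) ^ (2 * k) * (K * (n : ℝ) ^ k * 4 ^ k * ∫ x, ‖Y x‖ ^ (2 * k) ∂P) := by
        gcongr
        exact integral_norm_sum_pow_le hk hK0 hK hY h0
    _ = _ := by
        rw [two_mul, pow_add, one_div, inv_pow]
        field_simp

/-- The constant in the eighth moment bound for sums of centered operators. -/
def eighthConst (d : ℕ) : ℝ := 2 * d * (8 * Real.exp 1) ^ 4 * 4 ^ 4

lemma eighthConst_nonneg (d : ℕ) : 0 ≤ eighthConst d := by
  unfold eighthConst; positivity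

lemma integral_norm_sampleMean_pow_eight_le_of_operator {E F : Type*} [NormedAddCommGroup E]
    [InnerProductSpace ℝ E] [FiniteDimensional ℝ E] [CompleteSpace E] [NormedAddCommGroup F]
    [InnerProductSpace ℝ F] [CompleteSpace F] {n : ℕ} (hn : 0 < n) {Y : 𝒳 → E →L[ℝ] F}
    (hY : MemLp Y 8 P) (h0 : ∫ x, Y x ∂P = 0) :
    ∫ s : Fin n → 𝒳, ‖sampleMean Y s‖ ^ 8 ∂(Measure.pi fun _ => P)
      ≤ eighthConst (Module.finrank ℝ E) * (∫ x, ‖Y x‖ ^ 8 ∂P) / (n : ℝ) ^ 4 := by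
  -- The eighth moment is 2k with k = 4 = 2^(q+1), that is q = 1.
  refine integral_norm_sampleMean_pow_le (k := 4) (by norm_num)
    (K := 2 * Module.finrank ℝ E * (8 * Real.exp 1) ^ 4) (by positivity) hn (fun B => ?_)
    (by exact_mod_cast hY) h0
  refine (signAvg_norm_radSum_pow_le B 1).trans_eq ?_
  norm_num
  ring

/-- A vector is viewed as an operator from ℝ of the same norm. The domain has dimension 1, so the
constant does not depend on V. -/
lemma integral_norm_sampleMean_pow_eight_le {V : Type*} [NormedAddCommGroup V]
    [InnerProductSpace ℝ V] [CompleteSpace V] {n : ℕ} (hn : 0 < n) {Y : 𝒳 → V}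
    (hY : MemLp Y 8 P) (h0 : ∫ x, Y x ∂P = 0) :
    ∫ s : Fin n → 𝒳, ‖sampleMean Y s‖ ^ 8 ∂(Measure.pi fun _ => P)
      ≤ eighthConst 1 * (∫ x, ‖Y x‖ ^ 8 ∂P) / (n : ℝ) ^ 4 := by
  refine integral_norm_sampleMean_pow_le (k := 4) (by norm_num)
    (K := 2 * (1 : ℕ) * (8 * Real.exp 1) ^ 4) (by positivity) hn (fun B => ?_)
    (by exact_mod_cast hY) h0
  have h := signAvg_norm_radSum_pow_le
    (fun j => ContinuousLinearMap.toSpanSingleton ℝ (B j)) 1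
  have e : ∀ ε, radSum (fun j => ContinuousLinearMap.toSpanSingleton ℝ (B j)) ε
      = ContinuousLinearMap.toSpanSingleton ℝ (radSum B ε) := by
    intro ε
    ext
    simp [radSum]
  simp only [e, ContinuousLinearMap.norm_toSpanSingleton, Module.finrank_self] at h
  refine h.trans_eq ?_
  norm_num
  ring

lemma integral_norm_sampleMean_sq_le_of_operator {E F : Type*} [NormedAddCommGroup E]
    [InnerProductSpace ℝ E] [FiniteDimensional ℝ E] [CompleteSpace E] [NormedAddCommGroup F]
    [InnerProductSpace ℝ F] [CompleteSpace F] {n : ℕ} (hn : 0 < n) {Y : 𝒳 → E →L[ℝ] F}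
    (hY : MemLp Y 2 P) (h0 : ∫ x, Y x ∂P = 0) :
    ∫ s : Fin n → 𝒳, ‖sampleMean Y s‖ ^ 2 ∂(Measure.pi fun _ => P)
      ≤ 64 * Real.exp 2 * Real.log (max (Module.finrank ℝ E) 2 : ℕ) * (∫ x, ‖Y x‖ ^ 2 ∂P) / n := by
  have hlog : 0 ≤ Real.log (max (Module.finrank ℝ E) 2 : ℕ) := Real.log_natCast_nonneg _
  have h := integral_norm_sampleMean_pow_le (P := P) (k := 1) one_pos
    (K := 16 * Real.exp 2 * Real.log (max (Module.finrank ℝ E) 2 : ℕ)) (by positivity) hn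
    (fun B => by simpa using signAvg_norm_radSum_sq_le B) (Y := Y) (by exact_mod_cast hY) h0
  refine h.trans_eq ?_
  norm_num
  ring

lemma integral_norm_sampleMean_sq {V : Type*} [NormedAddCommGroup V] [InnerProductSpace ℝ V]
    [CompleteSpace V] {n : ℕ} (hn : 0 < n) {Y : 𝒳 → V} (hY : MemLp Y 2 P)
    (h0 : ∫ x, Y x ∂P = 0) :
    ∫ s : Fin n → 𝒳, ‖sampleMean Y s‖ ^ 2 ∂(Measure.pi fun _ => P) = (∫ x, ‖Y x‖ ^ 2 ∂P) / n := by
  have hn' : (n : ℝ) ≠ 0 := by exact_mod_cast hn.ne'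
  simp only [norm_sampleMean, mul_pow]
  rw [integral_const_mul, integral_norm_sum_sq hY h0]
  field_simp

lemma integral_sq_le_of_pow_eight_le {W : Type*} [NormedAddCommGroup W] {Y : 𝒳 → W}
    (hY : MemLp Y 8 P) {G : ℝ} (h : ∫ x, ‖Y x‖ ^ 8 ∂P ≤ G ^ 8) :
    ∫ x, ‖Y x‖ ^ 2 ∂P ≤ G ^ 2 := by
  have h2 : Integrable (fun x => ‖Y x‖ ^ 2) P :=
    (hY.mono_exponent (p := (2 : ℕ)) (by norm_num)).integrable_norm_pow (by norm_num)
  have h8 : Integrable (fun x => ‖Y x‖ ^ 8) P :=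
    MemLp.integrable_norm_pow (p := 8) (by exact_mod_cast hY) (by norm_num)
  have hj : (∫ x, ‖Y x‖ ^ 2 ∂P) ^ 4 ≤ ∫ x, (‖Y x‖ ^ 2) ^ 4 ∂P :=
    ConvexOn.map_integral_le (convexOn_pow 4) (continuous_pow 4).continuousOn isClosed_Ici
      (Filter.Eventually.of_forall fun x => pow_nonneg (norm_nonneg _) 2) h2
      (by simpa only [Function.comp_def, ← pow_mul] using h8)
  simp only [← pow_mul] at hj
  refine le_of_pow_le_pow_left₀ (n := 4) (by norm_num) (by positivity) (hj.trans (h.trans_eq ?_))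
  ring

end Moments

/-! ### Mean square and bias from the pointwise expansion -/

section L2

set_option linter.unusedSectionVars false

variable {Ω : Type*} [MeasurableSpace Ω] {μ : Measure Ω} [IsProbabilityMeasure μ]

lemma sq_integral_mul_le {u v : Ω → ℝ} (hu : MemLp u 2 μ) (hv : MemLp v 2 μ)
    (hu0 : ∀ ω, 0 ≤ u ω) (hv0 : ∀ ω, 0 ≤ v ω) :
    (∫ ω, u ω * v ω ∂μ) ^ 2 ≤ (∫ ω, u ω ^ 2 ∂μ) * ∫ ω, v ω ^ 2 ∂μ := by
  have h := integral_mul_le_Lp_mul_Lq_of_nonneg (μ := μ) (f := u) (g := v)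
    Real.HolderConjugate.two_two (Filter.Eventually.of_forall hu0)
    (Filter.Eventually.of_forall hv0) (by simpa using hu) (by simpa using hv)
  have h0 : 0 ≤ ∫ ω, u ω * v ω ∂μ := integral_nonneg fun ω => mul_nonneg (hu0 ω) (hv0 ω)
  have hU : 0 ≤ ∫ ω, u ω ^ 2 ∂μ := integral_nonneg fun ω => sq_nonneg _
  have hV : 0 ≤ ∫ ω, v ω ^ 2 ∂μ := integral_nonneg fun ω => sq_nonneg _
  simp only [Real.rpow_ofNat, ← Real.sqrt_eq_rpow] at h
  calc (∫ ω, u ω * v ω ∂μ) ^ 2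
      ≤ (Real.sqrt (∫ ω, u ω ^ 2 ∂μ) * Real.sqrt (∫ ω, v ω ^ 2 ∂μ)) ^ 2 := by gcongr
    _ = _ := by rw [mul_pow, Real.sq_sqrt hU, Real.sq_sqrt hV]

/-- Mean square and bias of `Δ`, which is `-v` up to terms of second order in the size `t` of the
fluctuations. -/
lemma mean_square_and_bias_le {E : Type*} [NormedAddCommGroup E] [InnerProductSpace ℝ E]
    [CompleteSpace E] {Δ v : Ω → E} {t a p : Ω → ℝ} {K M V A B lam β n : ℝ} (hn : 0 < n)
    (hlam : 0 < lam) (hβ : 0 ≤ β) (hΔ : AEStronglyMeasurable Δ μ)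
    (hv : MemLp v 2 μ) (hv0 : ∫ ω, v ω ∂μ = 0)
    (ht : MemLp t 8 μ) (ha : MemLp a 2 μ) (hp : MemLp p 2 μ)
    (ht0 : ∀ ω, 0 ≤ t ω) (ha0 : ∀ ω, 0 ≤ a ω) (hp0 : ∀ ω, 0 ≤ p ω)
    (h1 : ∀ᵐ ω ∂μ, ‖Δ ω‖ ≤ K * t ω) (h2 : ∀ᵐ ω ∂μ, ‖Δ ω + v ω‖ ≤ K * t ω ^ 2)
    (h3 : ∀ᵐ ω ∂μ, ‖Δ ω + v ω‖ ≤ (p ω + β * a ω) / lam * ‖Δ ω‖ + K * t ω ^ 3)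
    (hM : ∫ ω, t ω ^ 8 ∂μ ≤ M / n ^ 4) (hV : ∫ ω, ‖v ω‖ ^ 2 ∂μ ≤ V)
    (hA : ∫ ω, a ω ^ 2 ∂μ ≤ A) (hB : ∫ ω, p ω ^ 2 ∂μ ≤ B) :
    MemLp Δ 2 μ ∧
    ∫ ω, ‖Δ ω‖ ^ 2 ∂μ ≤ 2 * V + 2 * K ^ 2 * (1 + M) / n ^ 2 ∧
    ‖∫ ω, Δ ω ∂μ‖ ^ 2 ≤ 4 / lam ^ 2 * (B + β ^ 2 * A) * (2 * V + 2 * K ^ 2 * (1 + M) / n ^ 2)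
      + 2 * K ^ 2 * (1 + M) / n ^ 3 := by
  have htp : ∀ k : ℕ, k ≤ 8 → Integrable (fun ω => t ω ^ k) μ := by
    intro k hk
    have h : MemLp t k μ := ht.mono_exponent (by exact_mod_cast hk)
    simpa only [Real.norm_of_nonneg (ht0 _)] using h.integrable_norm_pow'
  -- The fourth and sixth moments are read off from the eighth through y² ≤ 1 + y⁴ and y³ ≤ 1 + y⁴
  -- with y = n t², in place of Hölder; hence the factor 1 + M.
  have ht8 : ∫ ω, (1 + n ^ 4 * t ω ^ 8) ∂μ ≤ 1 + M := by
    rw [integral_add (integrable_const _) ((htp 8 le_rfl).const_mul _), integral_const_mul]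
    have : n ^ 4 * ∫ ω, t ω ^ 8 ∂μ ≤ M := by
      calc n ^ 4 * ∫ ω, t ω ^ 8 ∂μ ≤ n ^ 4 * (M / n ^ 4) := by gcongr
        _ = M := by field_simp
    simpa using this
  have h8int : Integrable (fun ω => 1 + n ^ 4 * t ω ^ 8) μ :=
    (integrable_const _).add ((htp 8 le_rfl).const_mul _)
  have ht4 : ∫ ω, t ω ^ 4 ∂μ ≤ (1 + M) / n ^ 2 := by
    rw [le_div_iff₀ (by positivity), mul_comm, ← integral_const_mul]
    refine (integral_mono ((htp 4 (by norm_num)).const_mul _) h8int fun ω => ?_).trans ht8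
    have : n ^ 2 * t ω ^ 4 ≤ 1 + (n ^ 2 * t ω ^ 4) ^ 2 := by
      nlinarith [sq_nonneg (n ^ 2 * t ω ^ 4 - 1)]
    refine this.trans_eq (by ring)
  have ht6 : ∫ ω, t ω ^ 6 ∂μ ≤ (1 + M) / n ^ 3 := by
    rw [le_div_iff₀ (by positivity), mul_comm, ← integral_const_mul]
    refine (integral_mono ((htp 6 (by norm_num)).const_mul _) h8int fun ω => ?_).trans ht8
    have hy : 0 ≤ n * t ω ^ 2 := by positivity
    have : (n * t ω ^ 2) ^ 3 ≤ 1 + (n * t ω ^ 2) ^ 4 := by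
      rcases le_total (n * t ω ^ 2) 1 with h | h
      · have := pow_le_one₀ (n := 3) hy h
        have := pow_nonneg hy 4
        linarith
      · have := pow_le_pow_right₀ h (show 3 ≤ 4 by norm_num)
        linarith
    calc n ^ 3 * t ω ^ 6 = (n * t ω ^ 2) ^ 3 := by ring
      _ ≤ _ := this
      _ = _ := by ring
  have ht3 : (∫ ω, t ω ^ 3 ∂μ) ^ 2 ≤ (1 + M) / n ^ 3 := by
    have h := ConvexOn.map_integral_le (μ := μ) (f := fun ω => t ω ^ 3) (convexOn_pow 2)
      (continuous_pow 2).continuousOn isClosed_Ici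
      (Filter.Eventually.of_forall fun ω => pow_nonneg (ht0 ω) 3) (htp 3 (by norm_num))
      (by simpa only [Function.comp_def, ← pow_mul] using htp 6 (by norm_num))
    simp only [← pow_mul] at h
    exact h.trans ht6
  have htL2 : MemLp t 2 μ := ht.mono_exponent (by norm_num)
  have hΔL : MemLp Δ 2 μ := by
    refine (htL2.const_mul K).mono hΔ ?_
    filter_upwards [h1] with ω hω
    exact hω.trans (le_abs_self _)
  have heL : MemLp (fun ω => Δ ω + v ω) 2 μ := hΔL.add hv
  have hsq : ∀ {u : Ω → E}, MemLp u 2 μ → Integrable (fun ω => ‖u ω‖ ^ 2) μ := fun hu =>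
    MemLp.integrable_norm_pow (p := 2) (by exact_mod_cast hu) (by norm_num)
  have he2 : ∫ ω, ‖Δ ω + v ω‖ ^ 2 ∂μ ≤ K ^ 2 * ((1 + M) / n ^ 2) := by
    calc ∫ ω, ‖Δ ω + v ω‖ ^ 2 ∂μ ≤ ∫ ω, K ^ 2 * t ω ^ 4 ∂μ := by
          refine integral_mono_ae (hsq heL) ((htp 4 (by norm_num)).const_mul _) ?_
          filter_upwards [h2] with ω hω
          calc ‖Δ ω + v ω‖ ^ 2 ≤ (K * t ω ^ 2) ^ 2 := by gcongr
            _ = K ^ 2 * t ω ^ 4 := by ring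
      _ = K ^ 2 * ∫ ω, t ω ^ 4 ∂μ := integral_const_mul _ _
      _ ≤ _ := by gcongr
  have hms : ∫ ω, ‖Δ ω‖ ^ 2 ∂μ ≤ 2 * V + 2 * K ^ 2 * (1 + M) / n ^ 2 := by
    calc ∫ ω, ‖Δ ω‖ ^ 2 ∂μ ≤ ∫ ω, (2 * ‖v ω‖ ^ 2 + 2 * ‖Δ ω + v ω‖ ^ 2) ∂μ := by
          refine integral_mono (hsq hΔL) (((hsq hv).const_mul 2).add ((hsq heL).const_mul 2))
            fun ω => ?_
          have h : ‖Δ ω‖ ≤ ‖Δ ω + v ω‖ + ‖v ω‖ := by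
            simpa using norm_sub_le (Δ ω + v ω) (v ω)
          have h' := pow_le_pow_left₀ (norm_nonneg _) h 2
          have := add_sq_le (a := ‖Δ ω + v ω‖) (b := ‖v ω‖)
          simp only
          linarith
      _ = 2 * ∫ ω, ‖v ω‖ ^ 2 ∂μ + 2 * ∫ ω, ‖Δ ω + v ω‖ ^ 2 ∂μ := by
          rw [integral_add ((hsq hv).const_mul 2) ((hsq heL).const_mul 2), integral_const_mul,
            integral_const_mul]
      _ ≤ 2 * V + 2 * (K ^ 2 * ((1 + M) / n ^ 2)) := by gcongr
      _ = _ := by ring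
  refine ⟨hΔL, hms, ?_⟩
  set w : Ω → ℝ := fun ω => p ω + β * a ω with hw
  have hwL : MemLp w 2 μ := hp.add (ha.const_mul β)
  have hw0 : ∀ ω, 0 ≤ w ω := fun ω => add_nonneg (hp0 ω) (mul_nonneg hβ (ha0 ω))
  have hsqr : ∀ {u : Ω → ℝ}, MemLp u 2 μ → Integrable (fun ω => u ω ^ 2) μ := fun hu =>
    hu.integrable_sq
  have hw2 : ∫ ω, w ω ^ 2 ∂μ ≤ 2 * (B + β ^ 2 * A) := by
    calc ∫ ω, w ω ^ 2 ∂μ ≤ ∫ ω, (2 * p ω ^ 2 + 2 * β ^ 2 * a ω ^ 2) ∂μ := by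
          refine integral_mono (hsqr hwL) (((hsqr hp).const_mul 2).add ((hsqr ha).const_mul _))
            fun ω => ?_
          have := add_sq_le (a := p ω) (b := β * a ω)
          simp only [hw]
          nlinarith
      _ = 2 * ∫ ω, p ω ^ 2 ∂μ + 2 * β ^ 2 * ∫ ω, a ω ^ 2 ∂μ := by
          rw [integral_add ((hsqr hp).const_mul 2) ((hsqr ha).const_mul _), integral_const_mul,
            integral_const_mul]
      _ ≤ 2 * B + 2 * β ^ 2 * A := by gcongr
      _ = _ := by ring
  have hwΔ : Integrable (fun ω => w ω * ‖Δ ω‖) μ := hwL.integrable_mul hΔL.norm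
  -- Cauchy–Schwarz keeps E‖Δ‖² as a factor, so the bound on the squared bias inherits V, hence σ².
  have hcs := sq_integral_mul_le hwL hΔL.norm hw0 (fun ω => norm_nonneg (Δ ω))
  -- As v is centered, only the second order remainder contributes to the bias.
  have hmean : ∫ ω, Δ ω ∂μ = ∫ ω, (Δ ω + v ω) ∂μ := by
    rw [integral_add (hΔL.integrable (by norm_num)) (hv.integrable (by norm_num)), hv0, add_zero]
  have hbias : ‖∫ ω, Δ ω ∂μ‖ ≤ 1 / lam * (∫ ω, w ω * ‖Δ ω‖ ∂μ) + K * ∫ ω, t ω ^ 3 ∂μ := by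
    rw [hmean]
    calc ‖∫ ω, (Δ ω + v ω) ∂μ‖ ≤ ∫ ω, ‖Δ ω + v ω‖ ∂μ := norm_integral_le_integral_norm _
      _ ≤ ∫ ω, (1 / lam * (w ω * ‖Δ ω‖) + K * t ω ^ 3) ∂μ := by
          refine integral_mono_ae (heL.integrable (by norm_num)).norm
            ((hwΔ.const_mul _).add ((htp 3 (by norm_num)).const_mul _)) ?_
          filter_upwards [h3] with ω hω
          refine hω.trans_eq ?_
          simp only [hw]
          ring
      _ = _ := by
          rw [integral_add (hwΔ.const_mul _) ((htp 3 (by norm_num)).const_mul _),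
            integral_const_mul, integral_const_mul]
  have hB0 : 0 ≤ 2 * (B + β ^ 2 * A) := (integral_nonneg fun ω => sq_nonneg _).trans hw2
  calc ‖∫ ω, Δ ω ∂μ‖ ^ 2
      ≤ (1 / lam * (∫ ω, w ω * ‖Δ ω‖ ∂μ) + K * ∫ ω, t ω ^ 3 ∂μ) ^ 2 := by gcongr
    _ ≤ 2 * ((1 / lam * (∫ ω, w ω * ‖Δ ω‖ ∂μ)) ^ 2 + (K * ∫ ω, t ω ^ 3 ∂μ) ^ 2) := add_sq_le
    _ = 2 * (1 / lam ^ 2 * (∫ ω, w ω * ‖Δ ω‖ ∂μ) ^ 2 + K ^ 2 * (∫ ω, t ω ^ 3 ∂μ) ^ 2) := by ring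
    _ ≤ 2 * (1 / lam ^ 2 * ((2 * (B + β ^ 2 * A)) * (2 * V + 2 * K ^ 2 * (1 + M) / n ^ 2))
          + K ^ 2 * ((1 + M) / n ^ 3)) := by
        gcongr
        exact hcs.trans (mul_le_mul hw2 hms (integral_nonneg fun ω => sq_nonneg _) hB0)
    _ = _ := by ring

end L2

/-! ### The error of a single machine -/

section SingleMachine

variable {d : ℕ} {𝒳 : Type*} [MeasurableSpace 𝒳]

/-- The consequences of the assumptions that are used in the analysis of a single machine. -/
structure MachineModel (f : Vec d → 𝒳 → ℝ) (P : Measure 𝒳) (Θ : Set (Vec d)) (θs : Vec d)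
    (R ρ lam G H L : ℝ) (lip : 𝒳 → ℝ) : Prop where
  rho_pos : 0 < ρ
  lam_pos : 0 < lam
  L_nonneg : 0 ≤ L
  convex : Convex ℝ Θ
  convex_loss : ∀ x, ConvexOn ℝ Θ (fun θ => f θ x)
  ball_subset : Metric.ball θs ρ ⊆ Θ
  radius : ∀ θ ∈ Θ, ‖θ - θs‖ ≤ R
  twiceDiff : ∀ x, TwiceDiffOn (fun θ => f θ x) (Metric.ball θs ρ)
  lipschitz : ∀ x, ∀ θ ∈ Metric.ball θs ρ, ∀ θ' ∈ Metric.ball θs ρ,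
    ‖hess (fun t => f t x) θ' - hess (fun t => f t x) θ‖ ≤ lip x * ‖θ' - θ‖
  abs_integral_lip_le : |∫ y, lip y ∂P| ≤ L
  coercive : Coercive lam (hess (popRisk f P) θs)
  memLp_grad : MemLp (fun x => gradient (fun t => f t x) θs) 8 P
  integral_grad : ∫ x, gradient (fun t => f t x) θs ∂P = 0
  moment_grad : ∫ x, ‖gradient (fun t => f t x) θs‖ ^ 8 ∂P ≤ G ^ 8
  memLp_hess : MemLp (fun x => hess (fun t => f t x) θs - hess (popRisk f P) θs) 8 P
  integral_hess : ∫ x, (hess (fun t => f t x) θs - hess (popRisk f P) θs) ∂P = 0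
  moment_hess : ∫ x, ‖hess (fun t => f t x) θs - hess (popRisk f P) θs‖ ^ 8 ∂P ≤ H ^ 8
  memLp_lip : MemLp (fun x => lip x - ∫ y, lip y ∂P) 8 P
  integral_lip : ∫ x, (lip x - ∫ y, lip y ∂P) ∂P = 0
  moment_lip : ∫ x, ‖lip x - ∫ y, lip y ∂P‖ ^ 8 ∂P ≤ L ^ 8

variable {f : Vec d → 𝒳 → ℝ} {P : Measure 𝒳} [IsProbabilityMeasure P] {Θ : Set (Vec d)}
  {θs : Vec d} {R ρ lam G H L : ℝ} {lip : 𝒳 → ℝ}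

lemma exists_machineModel (hρ : 0 < ρ) (hlam : 0 < lam) (hL : 0 ≤ L)
    (hset : Setup f P Θ θs) (hpar : ParameterSpace Θ θs R) (hball : Metric.ball θs ρ ⊆ Θ)
    (hlsc : LocalStrongConvexity f P (Metric.ball θs ρ) θs lam)
    (hsm : Smoothness f P (Metric.ball θs ρ) G H L) :
    ∃ lip : 𝒳 → ℝ, MachineModel f P Θ θs R ρ lam G H L lip := by
  obtain ⟨lip, hlip, hlipL, hlip8, hlipc⟩ := hsm.hess_lipschitz
  have hself : θs ∈ Metric.ball θs ρ := Metric.mem_ball_self hρ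
  have hlint : Integrable lip P := hlipL.integrable (by norm_num)
  have hhint : Integrable (fun x => hess (fun t => f t x) θs) P := by
    have h := ((hsm.hess_memLp θs hself).integrable (by norm_num)).add
      (integrable_const (hess (popRisk f P) θs))
    simpa [Pi.add_def] using h
  have hdom : DominatedLoss f P θs ρ lip :=
    { twiceDiff := hsm.twiceDiff
      lipschitz := fun x θ hθ => hlip x θs hself θ hθ
      integrable_lip := hlint
      integrable_loss := fun θ hθ => hset.integrable_loss θ (hball hθ)
      integrable_grad := fun θ hθ => (hsm.grad_memLp θ hθ).integrable (by norm_num)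
      integrable_hess := hhint }
  have hmin : IsLocalMin (popRisk f P) θs := by
    filter_upwards [Metric.isOpen_ball.mem_nhds hself] with θ hθ
    rcases eq_or_ne θ θs with rfl | hne
    · exact le_rfl
    · exact (hset.unique_min θ (hball hθ) hne).le
  have heven : ∀ x : ℝ, ‖x‖ ^ 8 = x ^ 8 := fun x => Even.pow_abs (by decide) x
  -- Jensen, from the mean to the second moment and from there to the eighth.
  have hsq : (∫ y, lip y ∂P) ^ 2 ≤ L ^ 2 := by
    have h2 := integral_sq_le_of_pow_eight_le hlipL (by simpa only [heven] using hlip8)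
    simp only [Real.norm_eq_abs, sq_abs] at h2
    exact (ConvexOn.map_integral_le (even_two.convexOn_pow) (continuous_pow 2).continuousOn
      isClosed_univ (Filter.Eventually.of_forall fun x => Set.mem_univ _) hlint
      (hlipL.mono_exponent (by norm_num)).integrable_sq).trans h2
  refine ⟨lip, ⟨hρ, hlam, hL, hpar.convex, hset.convex_loss, hball, ?_, hsm.twiceDiff,
    hlip, abs_le_of_sq_le_sq hsq hL, ?_, hsm.grad_memLp θs hself,
    hdom.integral_gradient_eq_zero hρ hmin, hsm.grad_moment θs hself, hsm.hess_memLp θs hself, ?_,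
    hsm.hess_moment θs hself, hlipL.sub (memLp_const _), ?_, ?_⟩⟩
  · exact fun θ hθ => hpar.radius.2 (Set.mem_image_of_mem _ hθ)
  · intro v
    have h := hlsc.curvature.inner_nonneg_left v
    simp only [sub_apply, smul_apply, ContinuousLinearMap.id_apply, inner_sub_left,
      inner_smul_left, conj_trivial, real_inner_self_eq_norm_sq] at h
    linarith
  · rw [integral_sub hhint (integrable_const _), hdom.integral_hess hρ]
    simp
  · rw [integral_sub hlint (integrable_const _)]
    simp
  · simpa only [heven] using hlipc

/-- The constant in the eighth moment bound for the fluctuations. -/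
def fluctuationConst (d : ℕ) (G H L : ℝ) : ℝ :=
  3 ^ 7 * (eighthConst 1 * G ^ 8 + eighthConst d * H ^ 8 + eighthConst 1 * L ^ 8)

/-- The constant of the `1 / n ^ 2` term in the mean square error of a single machine. -/
def varianceConst (d : ℕ) (R ρ lam G H L : ℝ) : ℝ :=
  2 * expansionConst R ρ lam L ^ 2 * (1 + fluctuationConst d G H L)

/-- The constant of the `1 / n ^ 3` term in the squared bias of a single machine. -/
def biasConst (d : ℕ) (R ρ lam G H L : ℝ) : ℝ :=
  4 / lam ^ 2 * (64 * Real.exp 2 * Real.log (max d 2 : ℕ) * H ^ 2 + (2 * L / lam) ^ 2 * G ^ 2)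
    * varianceConst d R ρ lam G H L + varianceConst d R ρ lam G H L

lemma varianceConst_nonneg (d : ℕ) (R ρ lam G H L : ℝ) :
    0 ≤ varianceConst d R ρ lam G H L := by
  have h1 := eighthConst_nonneg 1
  have h2 := eighthConst_nonneg d
  have h3 : (0 : ℝ) ≤ G ^ 8 := Even.pow_nonneg (by decide) G
  have h4 : (0 : ℝ) ≤ H ^ 8 := Even.pow_nonneg (by decide) H
  unfold varianceConst fluctuationConst
  positivity

lemma biasConst_nonneg (d : ℕ) (R ρ lam G H L : ℝ) :
    0 ≤ biasConst d R ρ lam G H L := by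
  have h1 := varianceConst_nonneg d R ρ lam G H L
  have h2 : 0 ≤ Real.log (max d 2 : ℕ) := Real.log_natCast_nonneg _
  unfold biasConst
  positivity

lemma MachineModel.memLp_fluctuation (h : MachineModel f P Θ θs R ρ lam G H L lip) (n : ℕ) :
    MemLp (fun s : Fin n → 𝒳 => fluctuation f P θs lip s) 8 (Measure.pi fun _ => P) :=
  ((memLp_sampleMean h.memLp_grad n).norm.add (memLp_sampleMean h.memLp_hess n).norm).add
    (memLp_sampleMean h.memLp_lip n).norm

lemma MachineModel.integral_fluctuation_pow_le (h : MachineModel f P Θ θs R ρ lam G H L lip)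
    {n : ℕ} (hn : 0 < n) :
    ∫ s : Fin n → 𝒳, fluctuation f P θs lip s ^ 8 ∂(Measure.pi fun _ => P)
      ≤ fluctuationConst d G H L / (n : ℝ) ^ 4 := by
  have h1 := integral_norm_sampleMean_pow_eight_le hn h.memLp_grad h.integral_grad
  have h2 := integral_norm_sampleMean_pow_eight_le_of_operator hn h.memLp_hess h.integral_hess
  have h3 := integral_norm_sampleMean_pow_eight_le hn h.memLp_lip h.integral_lip
  rw [finrank_euclideanSpace_fin] at h2
  have i1 := MemLp.integrable_norm_pow (p := 8)
    (by exact_mod_cast memLp_sampleMean h.memLp_grad n) (by norm_num)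
  have i2 := MemLp.integrable_norm_pow (p := 8)
    (by exact_mod_cast memLp_sampleMean h.memLp_hess n) (by norm_num)
  have i3 := MemLp.integrable_norm_pow (p := 8)
    (by exact_mod_cast memLp_sampleMean h.memLp_lip n) (by norm_num)
  have i0 := MemLp.integrable_norm_pow (p := 8)
    (by exact_mod_cast h.memLp_fluctuation n) (by norm_num)
  have e0 : ∀ s : Fin n → 𝒳, ‖fluctuation f P θs lip s‖ ^ 8 = fluctuation f P θs lip s ^ 8 :=
    fun s => Even.pow_abs (by decide) _
  simp only [e0] at i0
  have c1 := eighthConst_nonneg 1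
  have c2 := eighthConst_nonneg d
  refine (integral_mono i0 (((i1.add i2).add i3).const_mul (3 ^ 7)) fun s => ?_).trans ?_
  · have hp := pow_sum_le_card_mul_sum_pow (s := (Finset.univ : Finset (Fin 3)))
      (f := ![‖sampleMean (fun x => gradient (fun t => f t x) θs) s‖,
        ‖sampleMean (fun x => hess (fun t => f t x) θs - hess (popRisk f P) θs) s‖,
        ‖sampleMean (fun x => lip x - ∫ y, lip y ∂P) s‖])
      (fun i _ => by fin_cases i <;> simp) 7
    simpa [Fin.sum_univ_three, fluctuation] using hp
  · have e := (integral_add (i1.add i2) i3).trans (congrArg (· + _) (integral_add i1 i2))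
    simp only [Pi.add_apply] at e ⊢
    rw [integral_const_mul, e, fluctuationConst, mul_div_assoc, add_div, add_div]
    gcongr
    · exact h1.trans (by gcongr; exact h.moment_grad)
    · exact h2.trans (by gcongr; exact h.moment_hess)
    · exact h3.trans (by gcongr; exact h.moment_lip)

lemma MachineModel.mean_square_and_bias (h : MachineModel f P Θ θs R ρ lam G H L lip)
    {n : ℕ} (hn : 0 < n) {Ω : Type*} [MeasurableSpace Ω] {μ : Measure Ω} [IsProbabilityMeasure μ]
    {S : Ω → Fin n → 𝒳} (hS : MeasurePreserving S μ (Measure.pi fun _ => P)) {T : Ω → Vec d}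
    (hT : Measurable T) (hmin : ∀ᵐ ω ∂μ, IsEmpMin f Θ (S ω) (T ω)) :
    MemLp (fun ω => T ω - θs) 2 μ ∧
    ∫ ω, ‖T ω - θs‖ ^ 2 ∂μ
      ≤ 2 / (n : ℝ) * asympVar f P θs + varianceConst d R ρ lam G H L / (n : ℝ) ^ 2 ∧
    ‖∫ ω, (T ω - θs) ∂μ‖ ^ 2
      ≤ 512 * Real.exp 2 / (lam ^ 2 * (n : ℝ) ^ 2)
          * (H ^ 2 * Real.log (max d 2 : ℕ) + L ^ 2 * G ^ 2 / lam ^ 2) * asympVar f P θs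
        + biasConst d R ρ lam G H L / (n : ℝ) ^ 3 := by
  have hn' : (0 : ℝ) < n := by exact_mod_cast hn
  have hlam := h.lam_pos
  have hL := h.L_nonneg
  set Q := hess (popRisk f P) θs with hQ
  have hg2 : MemLp (fun x => gradient (fun t => f t x) θs) 2 P :=
    h.memLp_grad.mono_exponent (by norm_num)
  have hh2 : MemLp (fun x => hess (fun t => f t x) θs - Q) 2 P :=
    h.memLp_hess.mono_exponent (by norm_num)
  have hvL : MemLp (fun x => Q.inverse (gradient (fun t => f t x) θs)) 2 P :=
    Q.inverse.comp_memLp' hg2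
  have hv0 : ∫ x, Q.inverse (gradient (fun t => f t x) θs) ∂P = 0 := by
    rw [ContinuousLinearMap.integral_comp_comm _ (hg2.integrable (by norm_num)), h.integral_grad,
      map_zero]
  have hcomm : ∀ s : Fin n → 𝒳, Q.inverse (sampleMean (fun x => gradient (fun t => f t x) θs) s)
      = sampleMean (fun x => Q.inverse (gradient (fun t => f t x) θs)) s := by
    intro s
    simp only [sampleMean, map_smul, map_sum]
  have mg := memLp_sampleMean hg2 n
  have mh := memLp_sampleMean hh2 n
  have mv := memLp_sampleMean hvL n
  have mf := h.memLp_fluctuation n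
  have hexp : ∀ᵐ ω ∂μ, _ := hmin.mono fun ω hω =>
    expansion_bounds h.rho_pos hlam hL h.convex h.convex_loss h.ball_subset h.twiceDiff h.lipschitz
      h.abs_integral_lip_le h.coercive hn hω (h.radius _ hω.1)
  have key := mean_square_and_bias_le (μ := μ) (Δ := fun ω => T ω - θs)
    (v := fun ω => sampleMean (fun x => Q.inverse (gradient (fun t => f t x) θs)) (S ω))
    (t := fun ω => fluctuation f P θs lip (S ω))
    (a := fun ω => ‖sampleMean (fun x => gradient (fun t => f t x) θs) (S ω)‖)
    (p := fun ω => ‖sampleMean (fun x => hess (fun t => f t x) θs - Q) (S ω)‖)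
    (K := expansionConst R ρ lam L) (M := fluctuationConst d G H L)
    (V := asympVar f P θs / n) (A := G ^ 2 / n)
    (B := 64 * Real.exp 2 * Real.log (max d 2 : ℕ) * H ^ 2 / n) (β := 2 * L / lam) hn' hlam
    (by positivity) (hT.sub_const θs).aestronglyMeasurable (mv.comp_measurePreserving hS)
    ((integral_comp_measurePreserving hS mv.1).trans
      ((integral_sampleMean (hvL.integrable (by norm_num)) hn).trans hv0))
    (mf.comp_measurePreserving hS) (mg.comp_measurePreserving hS).norm
    (mh.comp_measurePreserving hS).norm
    (fun ω => by unfold fluctuation; positivity) (fun ω => norm_nonneg _) (fun ω => norm_nonneg _)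
    (hexp.mono fun ω hω => hω.1) (hexp.mono fun ω hω => by rw [← hcomm]; exact hω.2.1)
    (hexp.mono fun ω hω => by rw [← hcomm]; exact hω.2.2)
    ((integral_comp_measurePreserving hS (mf.1.pow 8)).trans_le (h.integral_fluctuation_pow_le hn))
    ((integral_comp_measurePreserving hS (mv.1.norm.pow 2)).trans_le
      (integral_norm_sampleMean_sq hn hvL hv0).le)
    ((integral_comp_measurePreserving hS (mg.1.norm.pow 2)).trans_le (by
      refine (integral_norm_sampleMean_sq hn hg2 h.integral_grad).trans_le ?_
      gcongr
      exact integral_sq_le_of_pow_eight_le h.memLp_grad h.moment_grad))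
    ((integral_comp_measurePreserving hS (mh.1.norm.pow 2)).trans_le (by
      have hb := integral_norm_sampleMean_sq_le_of_operator hn hh2 h.integral_hess
      rw [finrank_euclideanSpace_fin] at hb
      have hlog : 0 ≤ Real.log (max d 2 : ℕ) := Real.log_natCast_nonneg _
      refine hb.trans ?_
      gcongr
      exact integral_sq_le_of_pow_eight_le h.memLp_hess h.moment_hess))
  obtain ⟨k1, k2, k3⟩ := key
  have hσ : 0 ≤ asympVar f P θs := integral_nonneg fun x => sq_nonneg _
  have hvar := varianceConst_nonneg d R ρ lam G H L
  have e1 : 2 * expansionConst R ρ lam L ^ 2 * (1 + fluctuationConst d G H L)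
      = varianceConst d R ρ lam G H L := rfl
  rw [e1] at k2 k3
  refine ⟨k1, k2.trans_eq (by ring), k3.trans ?_⟩
  set σ2 := asympVar f P θs
  set C := varianceConst d R ρ lam G H L
  set ℓ := Real.log (max d 2 : ℕ)
  have he : (1 : ℝ) ≤ Real.exp 2 := Real.one_le_exp (by norm_num)
  -- The constant 512 e² is 4 · 64 e² · 2. The other term only has 4 · 2² · 2 = 32, which is rounded
  -- up to the common constant.
  have e2 : 4 / lam ^ 2 * (64 * Real.exp 2 * ℓ * H ^ 2 / n + (2 * L / lam) ^ 2 * (G ^ 2 / n))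
        * (2 * (σ2 / n) + C / (n : ℝ) ^ 2) + C / (n : ℝ) ^ 3
      = (512 * Real.exp 2 * (H ^ 2 * ℓ) + 32 * (L ^ 2 * G ^ 2 / lam ^ 2))
          / (lam ^ 2 * (n : ℝ) ^ 2) * σ2 + biasConst d R ρ lam G H L / (n : ℝ) ^ 3 := by
    rw [biasConst]
    field_simp
    ring
  have e3 : 512 * Real.exp 2 / (lam ^ 2 * (n : ℝ) ^ 2) * (H ^ 2 * ℓ + L ^ 2 * G ^ 2 / lam ^ 2) * σ2
      = (512 * Real.exp 2 * (H ^ 2 * ℓ) + 512 * Real.exp 2 * (L ^ 2 * G ^ 2 / lam ^ 2))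
          / (lam ^ 2 * (n : ℝ) ^ 2) * σ2 := by
    field_simp
  rw [e2, e3]
  gcongr
  linarith

end SingleMachine

/-! ### Averaging over the machines -/

section Averaging

/-- The m diagonal terms of the squared sum give V/m; the off-diagonal ones are products of means,
at most B each. Averaging thus reduces the variance part but not the bias. As B ≥ 0, it can be added
on the diagonal as well. -/
lemma integral_norm_average_sq_le {Ω E : Type*} [MeasurableSpace Ω] {μ : Measure Ω}
    [NormedAddCommGroup E] [InnerProductSpace ℝ E] {m : ℕ} (hm : 0 < m) {Δ : Fin m → Ω → E}
    (hΔ : ∀ i, MemLp (Δ i) 2 μ)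
    (hcross : ∀ i j, i ≠ j →
      ∫ ω, inner ℝ (Δ i ω) (Δ j ω) ∂μ = inner ℝ (∫ ω, Δ i ω ∂μ) (∫ ω, Δ j ω ∂μ))
    {V B : ℝ} (hV : ∀ i, ∫ ω, ‖Δ i ω‖ ^ 2 ∂μ ≤ V) (hB : ∀ i, ‖∫ ω, Δ i ω ∂μ‖ ^ 2 ≤ B) :
    ∫ ω, ‖(1 / (m : ℝ)) • ∑ i, Δ i ω‖ ^ 2 ∂μ ≤ V / m + B := by
  have hm' : (0 : ℝ) < m := by exact_mod_cast hm
  have hB0 : 0 ≤ B := (sq_nonneg _).trans (hB ⟨0, hm⟩)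
  have hint : ∀ i j, Integrable (fun ω => inner ℝ (Δ i ω) (Δ j ω)) μ :=
    fun i j => integrable_inner_of_memLp (hΔ i) (hΔ j)
  have hij : ∀ i j, ∫ ω, inner ℝ (Δ i ω) (Δ j ω) ∂μ ≤ (if i = j then V else 0) + B := by
    intro i j
    split_ifs with h
    · subst h
      simp only [real_inner_self_eq_norm_sq]
      linarith [hV i]
    · rw [hcross i j h, zero_add]
      refine (real_inner_le_norm _ _).trans ?_
      have := two_mul_le_add_sq ‖∫ ω, Δ i ω ∂μ‖ ‖∫ ω, Δ j ω ∂μ‖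
      linarith [hB i, hB j]
  have e : ∀ ω, ‖(1 / (m : ℝ)) • ∑ i, Δ i ω‖ ^ 2
      = (1 / (m : ℝ)) ^ 2 * ∑ i, ∑ j, inner ℝ (Δ i ω) (Δ j ω) := by
    intro ω
    rw [norm_smul, mul_pow, ← real_inner_self_eq_norm_sq (∑ i, Δ i ω), sum_inner,
      Real.norm_eq_abs, sq_abs]
    simp only [inner_sum]
  simp only [e]
  rw [integral_const_mul, integral_finsetSum _ fun i _ => integrable_finsetSum _ fun j _ => hint i j]
  simp only [integral_finsetSum _ fun j _ => hint _ j]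
  calc (1 / (m : ℝ)) ^ 2 * ∑ i, ∑ j, ∫ ω, inner ℝ (Δ i ω) (Δ j ω) ∂μ
      ≤ (1 / (m : ℝ)) ^ 2 * ∑ i : Fin m, ∑ j : Fin m, ((if i = j then V else 0) + B) := by
        gcongr with i _ j _
        exact hij i j
    _ = V / m + B := by
        simp only [Finset.sum_add_distrib, Finset.sum_ite_eq, Finset.mem_univ, if_true,
          Finset.sum_const, Finset.card_univ, Fintype.card_fin, nsmul_eq_mul]
        field_simp

variable {𝒳 Ω : Type*} [MeasurableSpace 𝒳] [MeasurableSpace Ω] {P : Measure 𝒳} {μ : Measure Ω}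
  {m n : ℕ} {X : Fin m → Fin n → Ω → 𝒳}

lemma measurePreserving_dataset [IsProbabilityMeasure μ] (hX : ∀ i j, Measurable (X i j))
    (hP : ∀ i j, Measure.map (X i j) μ = P)
    (hind : iIndepFun (fun p : Fin m × Fin n => X p.1 p.2) μ) (i : Fin m) :
    MeasurePreserving (fun ω j => X i j ω) μ (Measure.pi fun _ => P) := by
  refine ⟨measurable_pi_iff.2 fun j => hX i j, ?_⟩
  have h : iIndepFun (fun j : Fin n => X i j) μ :=
    hind.precomp (g := fun j : Fin n => (i, j)) fun _ _ h => (Prod.mk.inj h).2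
  rw [h.map_fun_eq_pi_map fun j => (hX i j).aemeasurable]
  simp only [hP]

/-- Two machines read disjoint blocks of one independent family. -/
lemma indepFun_dataset (hX : ∀ i j, Measurable (X i j))
    (hind : iIndepFun (fun p : Fin m × Fin n => X p.1 p.2) μ) {i i' : Fin m} (hi : i ≠ i') :
    IndepFun (fun ω j => X i j ω) (fun ω j => X i' j ω) μ := by
  classical
  have hdisj : Disjoint (Finset.univ.filter fun p : Fin m × Fin n => p.1 = i)
      (Finset.univ.filter fun p : Fin m × Fin n => p.1 = i') := by
    rw [Finset.disjoint_filter]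
    intro p _ h1 h2
    exact hi (h1.symm.trans h2)
  have h := hind.indepFun_finset _ _ hdisj fun p => hX p.1 p.2
  let restrict : ∀ i : Fin m, ((Finset.univ.filter fun p : Fin m × Fin n => p.1 = i) → 𝒳) →
      Fin n → 𝒳 := fun i z j => z ⟨(i, j), by simp⟩
  have hmeas : ∀ i, Measurable (restrict i) := fun i =>
    measurable_pi_iff.2 fun j => measurable_pi_apply _
  exact h.comp (hmeas i) (hmeas i')

end Averaging

end AvgM

end

theorem theorem1 :
    ∃ c : ℝ, 0 < c ∧
      ∀ (d : ℕ) (R ρ lam G H L : ℝ), 0 < ρ → 0 < lam → 0 ≤ G → 0 ≤ H → 0 ≤ L →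
      ∃ C₁ C₂ : ℝ, 0 ≤ C₁ ∧ 0 ≤ C₂ ∧
        -- the statistical problem
        ∀ (𝒳 : Type*) [MeasurableSpace 𝒳] (P : Measure 𝒳) [IsProbabilityMeasure P]
          (f : AvgM.Vec d → 𝒳 → ℝ) (Θ : Set (AvgM.Vec d)) (θs : AvgM.Vec d),
          AvgM.Setup f P Θ θs →
          AvgM.ParameterSpace Θ θs R →
          Metric.ball θs ρ ⊆ Θ →
          AvgM.LocalStrongConvexity f P (Metric.ball θs ρ) θs lam →
          AvgM.Smoothness f P (Metric.ball θs ρ) G H L →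
        -- `m` machines with `n` samples each, all `m * n` samples i.i.d. with law `P`
        ∀ (m n : ℕ), 0 < m → 0 < n →
        ∀ (Ω : Type*) [MeasurableSpace Ω] (μ : Measure Ω) [IsProbabilityMeasure μ]
          (X : Fin m → Fin n → Ω → 𝒳),
          (∀ i j, Measurable (X i j)) →
          (∀ i j, Measure.map (X i j) μ = P) →
          iIndepFun (fun p : Fin m × Fin n => X p.1 p.2) μ →
        -- machine `i` computes from its own dataset a minimizer of its empirical risk
        ∀ (est : Fin m → (Fin n → 𝒳) → AvgM.Vec d),
          (∀ i, Measurable (est i)) →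
          (∀ i, ∀ᵐ ω ∂μ, AvgM.IsEmpMin f Θ (fun j => X i j ω) (est i (fun j => X i j ω))) →
          ∫ ω, ‖(1 / (m : ℝ)) • (∑ i, est i (fun j => X i j ω)) - θs‖ ^ 2 ∂μ
            ≤ 2 / ((n : ℝ) * m) * AvgM.asympVar f P θs
              + c / (lam ^ 2 * (n : ℝ) ^ 2)
                * (H ^ 2 * Real.log (max d 2 : ℕ) + L ^ 2 * G ^ 2 / lam ^ 2)
                * AvgM.asympVar f P θs
              + C₁ / ((m : ℝ) * (n : ℝ) ^ 2)
              + C₂ / (n : ℝ) ^ 3 := by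
  -- The second order term of the mean square is divided by m and gives C₁; the third order term of
  -- the squared bias is not, and gives C₂.
  refine ⟨512 * Real.exp 2, by positivity, fun d R ρ lam G H L hρ hlam _ _ hL =>
    ⟨AvgM.varianceConst d R ρ lam G H L, AvgM.biasConst d R ρ lam G H L,
      AvgM.varianceConst_nonneg _ _ _ _ _ _ _, AvgM.biasConst_nonneg _ _ _ _ _ _ _, ?_⟩⟩
  intro 𝒳 _ P _ f Θ θs hset hpar hball hlsc hsm m n hm hn Ω _ μ _ X hX hP hind est hest hmin
  obtain ⟨lip, hmodel⟩ := AvgM.exists_machineModel hρ hlam hL hset hpar hball hlsc hsm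
  have hm' : (m : ℝ) ≠ 0 := by exact_mod_cast hm.ne'
  have hS := AvgM.measurePreserving_dataset hX hP hind
  have key := fun i => hmodel.mean_square_and_bias hn (hS i) ((hest i).comp (hS i).measurable)
    (hmin i)
  have hcross : ∀ i j, i ≠ j →
      ∫ ω, inner ℝ (est i (fun k => X i k ω) - θs) (est j (fun k => X j k ω) - θs) ∂μ
        = inner ℝ (∫ ω, (est i (fun k => X i k ω) - θs) ∂μ)
          (∫ ω, (est j (fun k => X j k ω) - θs) ∂μ) := by
    intro i j hij
    have h : IndepFun (fun ω => est i (fun k => X i k ω) - θs)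
        (fun ω => est j (fun k => X j k ω) - θs) μ :=
      (AvgM.indepFun_dataset hX hind hij).comp ((hest i).sub_const θs) ((hest j).sub_const θs)
    exact h.integral_bilin ((key i).1.integrable (by norm_num))
      ((key j).1.integrable (by norm_num)) (innerSL ℝ)
  have h := AvgM.integral_norm_average_sq_le hm (fun i => (key i).1) hcross
    (fun i => (key i).2.1) (fun i => (key i).2.2)
  have e : ∀ ω, (1 / (m : ℝ)) • (∑ i, est i (fun j => X i j ω)) - θs
      = (1 / (m : ℝ)) • ∑ i, (est i (fun j => X i j ω) - θs) := by
    intro ω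
    rw [Finset.sum_sub_distrib, smul_sub, Finset.sum_const, Finset.card_univ, Fintype.card_fin,
      ← Nat.cast_smul_eq_nsmul ℝ, smul_smul, one_div_mul_cancel hm', one_smul]
  simp only [e]
  refine h.trans_eq ?_
  ring
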